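/- Let $\mathbb{T}=\mathbb{R}/\mathbb{Z}$, identified with $[0,1)$, let $\|x-y\|$ be the distance on $\mathbb{T}$ (distance of the difference to the nearest integer), and let $Tx=x+\alpha$ be the rotation by an irrational number $\alpha$ with bounded partial quotients. Let $f:\mathbb{T}\to(0,\infty)$ be piecewise constant with at least one discontinuity. Let $\xi_1,\dots,\xi_p\in[0,1)$ be its distinct discontinuity points and $d_i=\lim_{x\to\xi_i^-}f(x)-\lim_{x\to\xi_i^+}f(x)$ the jumps. Assume (P1) whenever $n_1,\dots,n_p\in\mathbb{Z}$ are not all zero and $\sum_{i=1}^p n_id_i=0$, there are $i<i'$ with $n_i\ne0$, $n_{i'}\neq0$ and $\xi_i-\xi_{i'}\in(\mathbb{Q}+\mathbb{Q}\alpha)\setminus(\mathbb{Z}+\mathbb{Z}\alpha)$; (P2) $\int_{\mathbb{T}} f(x)\,dx\notin\sum_{i=1}^p(\xi_i+\mathbb{Q}+\mathbb{Q}\alpha)\,d_i$. Put $f^{(n)}(x)=\sum_{0\le k<n}f(T^kx)$ for $n\ge0$ and $f^{(n)}(x)=-\sum_{n\le k<0}f(T^kx)$ for $n<0$. Let $T^f=(T^f_t)_{t\in\mathbb{R}}$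 be the special flow on $\mathbb{T}^f=\{(x,s)\in\mathbb{T}\times\mathbb{R}:0\le s<f(x)\}$, that is $T^f_t(x,s)=(T^nx,\,s+t-f^{(n)}(x))$, where $n\in\mathbb{Z}$ is the unique integer with $f^{(n)}(x)\le s+t<f^{(n+1)}(x)$. Equip $\mathbb{T}^f$ with the metric $d((x,s),(y,t))=\|x-y\|+|s-t|$ and with the normalised restriction $\mu$ of Lebesgue measure. Then there is a finite set $P\subset\mathbb{R}\setminus\{0\}$ such that for every $\gamma\in\mathbb{R}\setminus\{0\}$ the flow $T^f$ has the property $\mathrm{R}(\gamma,P)$: for every $\varepsilon>0$ there is $\kappa>0$ such that for every $N\in\mathbb{N}$ there are $\delta>0$ and a Borel set $Z\subset\mathbb{T}^f$ with $\mu(Z)>1-\varepsilon$ such that, whenever $x,x'\in Z$, $x'$ is not in the orbit of $x$ and $d(x,x')<\delta$, there are natural numbers $M,L\ge N$ with $L/M\ge\kappa$ and an element $\rho\in P$ with $$\frac{\#\{n\in\mathbb{Z}\cap[M,M+L]:\ d(T^f_{n\gamma}(x),T^f_{n\gamma+\rho}(x'))<\varepsilon\}}{L}>1-\varepsilon .$$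 -/

import Mathlib

open MeasureTheory Filter Topology

noncomputable section

/-- `α` has bounded partial quotients: the partial quotients `a₁, a₂, …` of its continued fraction
expansion `[a₀; a₁, a₂, …]` form a bounded sequence. -/
def HasBoundedPartialQuotients (α : ℝ) : Prop :=
  ∃ C : ℝ, ∀ (n : ℕ) (a : ℝ), (GenContFract.of α).partDens.get? n = some a → a ≤ C

/-- `f` is piecewise constant on the circle: off a finite set it is locally constant, i.e. it is
constant on each of the finitely many open arcs that the finite set cuts out. -/
def IsPiecewiseConstant (f : UnitAddCircle → ℝ) : Prop :=
  ∃ E : Set UnitAddCircle, E.Finite ∧ ∀ x ∉ E, ∀ᶠ y in 𝓝 x, f y = f x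

/-- The set `Ξ` of discontinuity points of `f`. -/
def discontinuities (f : UnitAddCircle → ℝ) : Set UnitAddCircle :=
  {ξ | ¬ ContinuousAt f ξ}

/-- The jump `d(ξ) = lim_{x → ξ⁻} f(x) - lim_{x → ξ⁺} f(x)`. Both one-sided limits exist when `f` is
piecewise constant. -/
def jump (f : UnitAddCircle → ℝ) (ξ : UnitAddCircle) : ℝ :=
  limUnder (𝓝[<] (0 : ℝ)) (fun h : ℝ => f (ξ + (h : UnitAddCircle))) -
    limUnder (𝓝[>] (0 : ℝ)) (fun h : ℝ => f (ξ + (h : UnitAddCircle)))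

/-- The representative in `[0, 1)` of a point of the circle. -/
def circleRep (ξ : UnitAddCircle) : ℝ := (AddCircle.equivIco (1 : ℝ) 0 ξ : ℝ)

/-- The real number `x` lies in `ℚ + ℚα`. -/
def InRatSpan (α x : ℝ) : Prop := ∃ r s : ℚ, x = r + s * α

/-- The real number `x` lies in `ℤ + ℤα`. -/
def InIntSpan (α x : ℝ) : Prop := ∃ m n : ℤ, x = m + n * α

/-- Property (P1): whenever integers `n_ξ`, `ξ ∈ Ξ`, not all zero, satisfy `∑ n_ξ d(ξ) = 0`, there
are distinct `ξ, η ∈ Ξ` with `n_ξ ≠ 0`, `n_η ≠ 0` and `ξ - η ∈ (ℚ + ℚα) \ (ℤ + ℤα)`. -/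
def PropertyP1 (α : ℝ) (f : UnitAddCircle → ℝ) : Prop :=
  ∀ n : UnitAddCircle →₀ ℤ, (n.support : Set UnitAddCircle) ⊆ discontinuities f → n ≠ 0 →
    ∑ ξ ∈ n.support, (n ξ : ℝ) * jump f ξ = 0 →
    ∃ ξ ∈ n.support, ∃ η ∈ n.support, ξ ≠ η ∧
      InRatSpan α (circleRep ξ - circleRep η) ∧ ¬ InIntSpan α (circleRep ξ - circleRep η)

/-- Property (P2): `∫ f ∉ ∑_{ξ ∈ Ξ} (ξ + ℚ + ℚα) d(ξ)`. The set `Ξ` is finite when `f` is piecewise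
constant. -/
def PropertyP2 (α : ℝ) (f : UnitAddCircle → ℝ) : Prop :=
  ∀ r s : UnitAddCircle → ℚ,
    ∫ x, f x ≠ ∑ᶠ ξ ∈ discontinuities f, (circleRep ξ + r ξ + s ξ * α) * jump f ξ

/-- The cocycle `f^{(n)}(x)`, `n ∈ ℤ`, of the rotation `T x = x + α`:
`f(x) + f(Tx) + … + f(T^{n-1}x)` for `n > 0`, `0` for `n = 0`, and
`-(f(T^n x) + … + f(T^{-1}x))` for `n < 0`. -/
def rotationCocycle (α : ℝ) (f : UnitAddCircle → ℝ) (n : ℤ) (x : UnitAddCircle) : ℝ :=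
  ∑ k ∈ Finset.Ico 0 n, f (x + k • (α : UnitAddCircle)) -
    ∑ k ∈ Finset.Ico n 0, f (x + k • (α : UnitAddCircle))

lemma rotationCocycle_succ (α : ℝ) (f : UnitAddCircle → ℝ) (n : ℤ) (x : UnitAddCircle) :
    rotationCocycle α f (n + 1) x = rotationCocycle α f n x + f (x + n • (α : UnitAddCircle)) := by
  unfold rotationCocycle
  rcases le_or_gt 0 n with h | h
  · have h1 : Finset.Ico 0 (n + 1) = insert n (Finset.Ico 0 n) := by
      ext k; simp only [Finset.mem_Ico, Finset.mem_insert]; omega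
    have h2 : Finset.Ico n 0 = ∅ := Finset.Ico_eq_empty (by omega)
    have h3 : Finset.Ico (n + 1) 0 = ∅ := Finset.Ico_eq_empty (by omega)
    rw [h1, h2, h3, Finset.sum_insert (by simp)]
    simp only [Finset.sum_empty]; ring
  · have h1 : Finset.Ico n 0 = insert n (Finset.Ico (n + 1) 0) := by
      ext k; simp only [Finset.mem_Ico, Finset.mem_insert]; omega
    have h2 : Finset.Ico 0 n = ∅ := Finset.Ico_eq_empty (by omega)
    have h3 : Finset.Ico 0 (n + 1) = ∅ := Finset.Ico_eq_empty (by omega)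
    rw [h1, h2, h3, Finset.sum_insert (by simp)]
    simp only [Finset.sum_empty]; ring

/-- The phase space `{(x, s) : 0 ≤ s < f(x)}` of the special flow, with the metric
`d((x, s), (y, t)) = ‖x - y‖ + |s - t|` and its Borel `σ`-algebra, which is the trace of the product
`σ`-algebra. -/
abbrev SpecialFlowSpace (f : UnitAddCircle → ℝ) : Type :=
  {z : WithLp 1 (UnitAddCircle × ℝ) // 0 ≤ z.snd ∧ z.snd < f z.fst}

/-- The restriction to the phase space of the product of the Lebesgue measures on the circle and on
the line; its total mass is `∫ f`. -/
def specialFlowArea (f : UnitAddCircle → ℝ) : Measure (SpecialFlowSpace f) :=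
  (volume : Measure (UnitAddCircle × ℝ)).comap (fun z => (z.1.fst, z.1.snd))

/-- The area on the phase space, normalised to a probability measure. -/
def specialFlowMeasure (f : UnitAddCircle → ℝ) : Measure (SpecialFlowSpace f) :=
  (specialFlowArea f Set.univ)⁻¹ • specialFlowArea f

open Classical in
/-- The special flow over the rotation by `α` and under `f`:
`T^f_t(x, s) = (T^n x, s + t - f^{(n)}(x))`, where `n ∈ ℤ` is the number with
`f^{(n)}(x) ≤ s + t < f^{(n+1)}(x)`. When `f` is positive and piecewise constant, such an `n` exists
and is unique, so that the last branch is never used. -/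
def specialFlow (α : ℝ) (f : UnitAddCircle → ℝ) (t : ℝ) (z : SpecialFlowSpace f) :
    SpecialFlowSpace f :=
  if h : ∃ n : ℤ, rotationCocycle α f n z.1.fst ≤ z.1.snd + t ∧
      z.1.snd + t < rotationCocycle α f (n + 1) z.1.fst then
    ⟨WithLp.toLp 1 (z.1.fst + h.choose • (α : UnitAddCircle),
        z.1.snd + t - rotationCocycle α f h.choose z.1.fst), by
      have h1 := h.choose_spec.1
      have h2 := h.choose_spec.2
      rw [rotationCocycle_succ] at h2
      exact ⟨sub_nonneg.2 h1, by
        show z.1.snd + t - rotationCocycle α f h.choose z.1.fst <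
          f (z.1.fst + h.choose • (α : UnitAddCircle))
        linarith⟩⟩
  else z

/-- The property `R(t₀, P)` of a flow `(S_t)` on a metric space `X` with a Borel probability measure
`μ`. Here `κ` depends on `ε` only, while `δ` and `Z` depend on `ε` and `N`. -/
def HasRatnerProperty {X : Type*} [MetricSpace X] [MeasurableSpace X] [BorelSpace X]
    (μ : Measure X) (S : ℝ → X → X) (t₀ : ℝ) (P : Finset ℝ) : Prop :=
  ∀ ε : ℝ, 0 < ε → ∃ κ : ℝ, 0 < κ ∧ ∀ N : ℕ, ∃ δ : ℝ, 0 < δ ∧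
    ∃ Z : Set X, MeasurableSet Z ∧ 1 - ε < μ.real Z ∧
      ∀ x ∈ Z, ∀ x' ∈ Z, (∀ t : ℝ, S t x ≠ x') → dist x x' < δ →
        ∃ M L : ℕ, N ≤ M ∧ N ≤ L ∧ κ ≤ (L : ℝ) / (M : ℝ) ∧ ∃ ρ ∈ P,
          1 - ε < (Set.ncard {n : ℕ | M ≤ n ∧ n ≤ M + L ∧
            dist (S (n * t₀) x) (S (n * t₀ + ρ) x') < ε} : ℝ) / (L : ℝ)

end

/-!
The functions `n ↦ f^{(n)}(x)` and `n ↦ f^{(n)}(y)` of two points at distance `h` drift apart only at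
the times when the short arc from `x + nα` to `y + nα` meets a discontinuity `ξ`, and then by the jump
`d(ξ)`. As `α` is badly approximable, the first such time is at most `C / h` (the orbit of an arc of
length `h` covers the circle in time `O(1 / h)`, `IsBadlyApproximable.exists_hit`), and in a time
window of length `c / h` no discontinuity is met twice and no two discontinuities with difference in
`(ℚ + ℚα) \ (ℤ + ℤα)` are both met (`IsPiecewiseConstant.exists_separated`). Cut the window after the
first meeting into `#Ξ + 1` blocks; at most `#Ξ` of them contain a meeting, so along one block
(`exists_constant_block`) the difference of the cocycles is a constant `±∑_{ξ ∈ S} d(ξ)`, where `S` is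
the non-empty set of discontinuities met so far. By (P1) this constant is not zero: a vanishing sum
would put two of the separated discontinuities into `S`. So the finite set `P` consists of the non-zero
numbers `±∑_{ξ ∈ S} d(ξ)`, and the block has length and position comparable to `1 / h`, which gives a
lower bound for `L / M` (`IsPiecewiseConstant.exists_cocycle_drift`,
`IsPiecewiseConstant.exists_flow_drift`).

During such a block `T_t(x, s)` and `T_{t+ρ}(y, s')` stay at their initial distance, except when
`T_t(x, s)` is within `δ` of the floor or the roof of the phase space
(`dist_specialFlow_of_drift`). The special flow preserves the area
(`measurePreserving_specialFlow`), so the maximal ergodic inequality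
(`exists_measurableSet_visits_le`) bounds the proportion of such visits along all initial pieces of
the orbit at once, outside a set whose measure is small with `δ`. No ergodicity of `T_γ` is needed,
so the argument works for every `γ ≠ 0`.
-/

noncomputable section

/-! ### Badly approximable numbers -/

/-- `α` is badly approximable with constant `c`: `|q| |q α - p| ≥ c` for all integers `p` and
`q ≠ 0`. Negative `q` are allowed, so that the notion is visibly invariant under `α ↦ -α`. -/
def IsBadlyApproximable (α c : ℝ) : Prop :=
  0 < c ∧ ∀ q : ℤ, q ≠ 0 → ∀ p : ℤ, c ≤ |(q : ℝ)| * |q * α - p|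

lemma IsBadlyApproximable.neg {α c : ℝ} (h : IsBadlyApproximable α c) :
    IsBadlyApproximable (-α) c := by
  refine ⟨h.1, fun q hq p => ?_⟩
  have := h.2 (-q) (by omega) p
  push_cast at this
  rw [abs_neg] at this
  convert this using 3
  ring

lemma exists_int_contsAux (α : ℝ) (n : ℕ) :
    (∃ A B : ℤ, (GenContFract.of α).contsAux n = ⟨(A : ℝ), (B : ℝ)⟩) ∧
      ∃ A B : ℤ, (GenContFract.of α).contsAux (n + 1) = ⟨(A : ℝ), (B : ℝ)⟩ := by
  induction n with
  | zero =>
    refine ⟨⟨1, 0, by simp [GenContFract.contsAux]⟩, ⌊α⌋, 1, by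
      simp [GenContFract.contsAux, GenContFract.of_h_eq_floor]⟩
  | succ n ih =>
    refine ⟨ih.2, ?_⟩
    obtain ⟨⟨A, B, h1⟩, A', B', h2⟩ := ih
    rcases hs : (GenContFract.of α).s.get? n with _ | gp
    · refine ⟨A', B', ?_⟩
      rw [← h2]
      exact GenContFract.contsAux_stable_step_of_terminated hs
    · obtain ⟨ha, z, hb⟩ := GenContFract.of_partNum_eq_one_and_exists_int_partDen_eq hs
      refine ⟨z * A' + A, z * B' + B, ?_⟩
      rw [GenContFract.contsAux_recurrence hs h1 h2, ha, hb]
      push_cast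
      simp

/-- The `n`-th convergent differs from an irrational number with partial quotients at most `C` by
at least `1 / ((C + 2) Bₙ²)`. -/
lemma le_abs_sub_convs {α C : ℝ} (hα : Irrational α)
    (hC : ∀ (n : ℕ) (a : ℝ), (GenContFract.of α).partDens.get? n = some a → a ≤ C) (n : ℕ) :
    ∀ B : ℝ, (GenContFract.of α).dens n = B → 1 ≤ B ∧
      1 ≤ (C + 2) * B ^ 2 * |α - (GenContFract.of α).convs n| := by
  intro B hB
  have hterm : ∀ m, ¬ (GenContFract.of α).TerminatedAt m := by
    intro m hm
    have : (GenContFract.of α).Terminates := ⟨m, hm⟩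
    rw [GenContFract.terminates_iff_rat] at this
    obtain ⟨q, hq⟩ := this
    exact hα ⟨q, hq.symm⟩
  have hst : ∀ m, ∃ ifp, GenContFract.IntFractPair.stream α m = some ifp := by
    intro m
    rcases m with _ | m
    · exact ⟨_, rfl⟩
    · have := hterm m
      rw [GenContFract.of_terminatedAt_n_iff_succ_nth_intFractPair_stream_eq_none] at this
      exact Option.ne_none_iff_exists'.1 this
  obtain ⟨ifp, hifp⟩ := hst n
  obtain ⟨ifp', hifp'⟩ := hst (n + 1)
  obtain ⟨i, hi, hfr, hof⟩ := GenContFract.IntFractPair.succ_nth_stream_eq_some_iff.1 hifp'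
  obtain rfl : ifp = i := by rw [hifp] at hi; exact Option.some.inj hi
  have hfr0 : 0 < ifp.fr := lt_of_le_of_ne
    (GenContFract.IntFractPair.nth_stream_fr_nonneg hifp) (Ne.symm hfr)
  have hs := GenContFract.get?_of_eq_some_of_succ_get?_intFractPair_stream hifp'
  have hle : (ifp'.b : ℝ) ≤ C := hC n _ (GenContFract.partDen_eq_s_b hs)
  have hinv : ifp.fr⁻¹ < C + 1 := by
    have h1 : ifp'.b = ⌊ifp.fr⁻¹⌋ := by rw [← hof]; rfl
    have h2 := Int.lt_floor_add_one ifp.fr⁻¹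
    rw [← h1] at h2
    linarith
  have hB' : ((GenContFract.of α).contsAux (n + 1)).b = B := by
    rw [← hB]; rfl
  have hB1 : 1 ≤ B := by
    rw [← hB]
    have := GenContFract.succ_nth_fib_le_of_nth_den (v := α) (n := n) (Or.inr (hterm _))
    have h2 : (1 : ℝ) ≤ Nat.fib (n + 1) := by exact_mod_cast Nat.fib_pos.2 (Nat.succ_pos n)
    linarith
  have hpB0 : 0 ≤ ((GenContFract.of α).contsAux n).b := GenContFract.zero_le_of_contsAux_b
  have hpB : ((GenContFract.of α).contsAux n).b ≤ B := by
    rcases n with _ | n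
    · simp [GenContFract.contsAux]; linarith
    · rw [← hB]
      exact GenContFract.of_den_mono
  have key := GenContFract.sub_convs_eq hifp
  simp only [hfr, if_false, hB'] at key
  refine ⟨hB1, ?_⟩
  rw [key, abs_div, abs_pow, abs_neg, abs_one, one_pow]
  set pB := ((GenContFract.of α).contsAux n).b
  have hi0 : 0 < ifp.fr⁻¹ := inv_pos.2 hfr0
  have hD : 0 < B * (ifp.fr⁻¹ * B + pB) := by positivity
  rw [abs_of_pos hD, mul_one_div, le_div_iff₀ hD]
  nlinarith [mul_nonneg (by linarith : (0:ℝ) ≤ B) (by linarith : (0:ℝ) ≤ B - pB),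
    mul_nonneg (mul_nonneg (by linarith : (0:ℝ) ≤ B) (by linarith : (0:ℝ) ≤ B))
      (by linarith : (0:ℝ) ≤ C + 1 - ifp.fr⁻¹)]

/-- Consecutive continuants have determinant `±1`, so a convergent is in lowest terms: if it equals
`q` then its denominator is at most that of `q`. -/
lemma dens_le_of_convs_eq {α : ℝ} (hα : Irrational α) (n : ℕ) (q : ℚ)
    (hq : (GenContFract.of α).convs n = q) (h1 : 1 ≤ (GenContFract.of α).dens n) :
    (GenContFract.of α).dens n ≤ q.den := by
  have hterm : ¬ (GenContFract.of α).TerminatedAt n := by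
    intro hm
    have : (GenContFract.of α).Terminates := ⟨n, hm⟩
    rw [GenContFract.terminates_iff_rat] at this
    obtain ⟨q, hq⟩ := this
    exact hα ⟨q, hq.symm⟩
  have hdet : (GenContFract.of α).nums n * (GenContFract.of α).dens (n + 1) -
      (GenContFract.of α).dens n * (GenContFract.of α).nums (n + 1) = (-1) ^ (n + 1) :=
    SimpContFract.determinant (s := SimpContFract.of α) hterm
  obtain ⟨⟨A, B, hAB⟩, A', B', hAB'⟩ := exists_int_contsAux α (n + 1)
  have e1 : (GenContFract.of α).nums n = A := by
    change ((GenContFract.of α).contsAux (n + 1)).a = A; rw [hAB]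
  have e2 : (GenContFract.of α).dens n = B := by
    change ((GenContFract.of α).contsAux (n + 1)).b = B; rw [hAB]
  have e3 : (GenContFract.of α).nums (n + 1) = A' := by
    change ((GenContFract.of α).contsAux (n + 2)).a = A'; rw [hAB']
  have e4 : (GenContFract.of α).dens (n + 1) = B' := by
    change ((GenContFract.of α).contsAux (n + 2)).b = B'; rw [hAB']
  rw [GenContFract.conv_eq_num_div_den, e1, e2] at hq
  rw [e1, e2, e3, e4] at hdet
  rw [e2] at h1 ⊢
  have hB : (0 : ℝ) < B := by linarith
  have hd : (0 : ℝ) < q.den := by exact_mod_cast q.pos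
  have hq' : (A : ℝ) * q.den = q.num * B := by
    rw [Rat.cast_def, div_eq_div_iff hB.ne' hd.ne'] at hq
    exact hq
  have hdet' : A * B' - B * A' = (-1) ^ (n + 1) := by exact_mod_cast hdet
  have hq'' : A * q.den = q.num * B := by exact_mod_cast hq'
  have hdvd : B ∣ (q.den : ℤ) := by
    have h3 : (-1 : ℤ) ^ (n + 1) * q.den = B * (q.num * B' - A' * q.den) := by
      rw [← hdet']; linear_combination B' * hq''
    have h4 : B ∣ (-1 : ℤ) ^ (n + 1) * q.den := ⟨_, h3⟩
    rcases neg_one_pow_eq_or ℤ (n + 1) with h | h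
    · simpa [h] using h4
    · simpa [h] using h4
  exact_mod_cast Int.le_of_dvd (by exact_mod_cast q.pos) hdvd

/-- An irrational number with bounded partial quotients is badly approximable. By Legendre's
theorem only the convergents need to be examined. -/
theorem HasBoundedPartialQuotients.exists_isBadlyApproximable {α : ℝ} (hα : Irrational α)
    (h : HasBoundedPartialQuotients α) : ∃ c, IsBadlyApproximable α c := by
  obtain ⟨C, hC⟩ := h
  set K : ℝ := max (C + 2) 2
  have hK : 2 ≤ K := le_max_right _ _
  have hKC : C + 2 ≤ K := le_max_left _ _
  have key : ∀ r : ℚ, 1 / K ≤ (r.den : ℝ) ^ 2 * |α - r| := by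
    intro r
    have hd : (1 : ℝ) ≤ r.den := by exact_mod_cast r.pos
    rw [div_le_iff₀ (by linarith)]
    by_cases hr : |α - r| < 1 / (2 * (r.den : ℝ) ^ 2)
    · obtain ⟨n, hn⟩ := Real.exists_convs_eq_rat hr
      obtain ⟨h1, h2⟩ := le_abs_sub_convs hα hC n _ rfl
      have h3 := dens_le_of_convs_eq hα n r hn h1
      rw [hn] at h2
      set B := (GenContFract.of α).dens n
      have h4 : B ^ 2 ≤ (r.den : ℝ) ^ 2 := by gcongr
      calc (1 : ℝ) ≤ (C + 2) * B ^ 2 * |α - r| := h2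
        _ ≤ K * B ^ 2 * |α - r| := by gcongr
        _ ≤ K * (r.den : ℝ) ^ 2 * |α - r| := by gcongr
        _ = _ := by ring
    · push Not at hr
      rw [div_le_iff₀ (by positivity)] at hr
      nlinarith [mul_nonneg (sq_nonneg (r.den : ℝ)) (abs_nonneg (α - r))]
  refine ⟨1 / K, by positivity, fun q hq p => ?_⟩
  have hq0 : (q : ℝ) ≠ 0 := by exact_mod_cast hq
  have h1 := key ((p : ℚ) / q)
  have hden : (((p : ℚ) / q).den : ℝ) ≤ |(q : ℝ)| := by
    have h2 : ((((p : ℚ) / q).den : ℕ) : ℤ) ∣ q := by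
      have := Rat.den_dvd p q
      simpa [Rat.divInt_eq_div] using this
    have h3 := Int.le_of_dvd (abs_pos.2 hq) ((dvd_abs _ _).2 h2)
    exact_mod_cast h3
  have h4 : |(q : ℝ) * α - p| = |(q : ℝ)| * |α - (((p : ℚ) / q : ℚ) : ℝ)| := by
    rw [← abs_mul]; congr 1; push_cast; field_simp
  rw [h4, ← mul_assoc, ← sq]
  exact h1.trans (by gcongr)

/-- The orbit of a badly approximable rotation meets every arc of length `h` within time `C / h`.
If `p / q` is a Dirichlet approximation with `q ≤ Q ≈ 1 / h`, then `q ≥ c (Q + 1)`, and the first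
`q` points of the orbit stay close to the `q` points `k p / q`. -/
theorem IsBadlyApproximable.exists_hit {α c : ℝ} (hα : IsBadlyApproximable α c) :
    ∃ C : ℝ, 0 < C ∧ ∀ h : ℝ, 0 < h → h < 1 → ∀ x : ℝ, ∃ k : ℕ, (k : ℝ) ≤ C / h ∧
      ∃ m : ℤ, ∃ t ∈ Set.Ioo 0 h, x + k * α + t = m := by
  obtain ⟨hc, hba⟩ := hα
  have hc' : 0 < 1 / c := by positivity
  refine ⟨2 * (1 / c + 1), by positivity, fun h h0 h1 x => ?_⟩
  set Y : ℝ := 2 * (1 / c + 1) / h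
  have hY : 2 < Y := by
    rw [lt_div_iff₀ h0]; nlinarith
  set Q : ℕ := ⌊Y⌋₊
  have hQ1 : 0 < Q := Nat.floor_pos.2 (by linarith)
  have hQY : (Q : ℝ) ≤ Y := Nat.floor_le (by linarith)
  have hYQ : Y < Q + 1 := Nat.lt_floor_add_one Y
  obtain ⟨r, hr, hrQ⟩ := Real.exists_rat_abs_sub_le_and_den_le α hQ1
  set q : ℕ := r.den
  have hq0 : 0 < q := r.pos
  have hq0' : (0 : ℝ) < q := by exact_mod_cast hq0
  have hQ' : (0 : ℝ) < (Q : ℝ) + 1 := by positivity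
  have hr' : r = (r.num : ℝ) / q := by rw [Rat.cast_def]
  have hqc : c * (Q + 1) ≤ q := by
    have h2 := hba q (by exact_mod_cast hq0.ne') r.num
    have h3 : |((q : ℤ) : ℝ) * α - r.num| = q * |α - r| := by
      rw [hr', ← abs_of_pos hq0', ← abs_mul, abs_of_pos hq0']
      congr 1
      push_cast
      field_simp
    rw [h3] at h2
    have h4 : (q : ℝ) * |α - r| ≤ 1 / (Q + 1) := by
      calc (q : ℝ) * |α - r| ≤ q * (1 / ((Q + 1) * q)) := by gcongr
        _ = 1 / (Q + 1) := by field_simp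
    have h5 : c ≤ q * (1 / (Q + 1)) := by
      refine h2.trans ?_
      rw [show |((q : ℤ) : ℝ)| = q by simp]
      gcongr
    rw [mul_one_div, le_div_iff₀ hQ'] at h5
    exact h5
  -- `h / 2` is added so that the approximation errors of either sign are harmless
  set z : ℝ := x + h / 2
  obtain ⟨k, hkq, m, hkm⟩ : ∃ k : ℕ, k < q ∧ ∃ m : ℤ, (k : ℤ) * r.num + ⌊q * z⌋ = q * m := by
    have hcop : IsCoprime r.num (q : ℤ) := Int.isCoprime_iff_gcd_eq_one.2 r.reduced
    obtain ⟨u, v, huv⟩ := hcop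
    have hqz : (q : ℤ) ≠ 0 := by exact_mod_cast hq0.ne'
    refine ⟨((-⌊q * z⌋ * u) % q).toNat, ?_, ?_⟩
    · have := Int.emod_lt_of_pos (-⌊q * z⌋ * u) (by exact_mod_cast hq0 : (0 : ℤ) < q)
      have := Int.emod_nonneg (-⌊q * z⌋ * u) hqz
      omega
    · rw [Int.toNat_of_nonneg (Int.emod_nonneg _ hqz)]
      rw [Int.emod_def]
      refine ⟨⌊q * z⌋ * v - ((-⌊q * z⌋ * u) / q) * r.num, ?_⟩
      linear_combination (-⌊q * z⌋) * huv
  refine ⟨k, ?_, m, m - x - k * α, ?_, by ring⟩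
  · have : (k : ℝ) ≤ Q := by exact_mod_cast hkq.le.trans hrQ
    exact this.trans hQY
  -- the distance from `z + k α` to `m` is at most `1 / q + 1 / (Q + 1) ≤ h / 2`
  have e1 : |(k : ℝ) * (α - r)| < 1 / (Q + 1) := by
    rw [abs_mul, abs_of_nonneg (by positivity : (0 : ℝ) ≤ k)]
    calc (k : ℝ) * |α - r| ≤ k * (1 / ((Q + 1) * q)) := by gcongr
      _ < q * (1 / ((Q + 1) * q)) := by gcongr
      _ = 1 / (Q + 1) := by field_simp
  have hkm' : (k : ℝ) * r.num + ⌊q * z⌋ = q * m := by exact_mod_cast hkm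
  have e2 : (k : ℝ) * r = m - ⌊q * z⌋ / q := by
    rw [hr']; field_simp; linarith
  have e3 : (⌊q * z⌋ : ℝ) / q ≤ z := by
    rw [div_le_iff₀ hq0']; linarith [Int.floor_le (q * z)]
  have e4 : z < (⌊q * z⌋ : ℝ) / q + 1 / q := by
    rw [← add_div, lt_div_iff₀ hq0']; linarith [Int.lt_floor_add_one (q * z)]
  have e5 : 1 / (q : ℝ) ≤ 1 / c * (1 / (Q + 1)) := by
    rw [one_div_mul_one_div]; exact one_div_le_one_div_of_le (by positivity) hqc
  have e6 : 1 / c * (1 / (Q + 1)) + 1 / ((Q : ℝ) + 1) < h / 2 := by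
    have : Y * h = 2 * (1 / c + 1) := by simp only [Y]; field_simp
    have h2 : (1 / c + 1) / ((Q : ℝ) + 1) < h / 2 := by
      rw [div_lt_iff₀ hQ']; nlinarith
    calc _ = (1 / c + 1) / ((Q : ℝ) + 1) := by ring
      _ < _ := h2
  have e7 : (k : ℝ) * α = k * (α - r) + k * r := by ring
  have hz : x = z - h / 2 := by simp only [z]; ring
  have hinv : 0 < 1 / ((Q : ℝ) + 1) := by positivity
  have hq3 : 0 < 1 / (q : ℝ) := by positivity
  rw [abs_lt] at e1
  constructor
  · rw [e7, e2, hz]; linarith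
  · rw [e7, e2, hz]; linarith

/-! ### Piecewise constant functions on the circle -/

section PiecewiseConstant

variable {f : UnitAddCircle → ℝ}

lemma continuous_arc (x : UnitAddCircle) : Continuous fun t : ℝ => x + (t : UnitAddCircle) :=
  continuous_const.add (AddCircle.continuous_mk' 1)

lemma norm_coe_circle_le (t : ℝ) : ‖(t : UnitAddCircle)‖ ≤ |t| := by
  rw [UnitAddCircle.norm_eq]
  simpa using round_le t 0

lemma coe_circle_eq_zero_iff {t : ℝ} : (t : UnitAddCircle) = 0 ↔ ∃ m : ℤ, t = m := by
  rw [AddCircle.coe_eq_zero_iff]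
  simp [eq_comm]

lemma coe_circle_ne_zero {t : ℝ} (h0 : t ≠ 0) (h1 : |t| < 1) : (t : UnitAddCircle) ≠ 0 := by
  intro h
  obtain ⟨m, rfl⟩ := coe_circle_eq_zero_iff.1 h
  have : |m| < 1 := by exact_mod_cast h1
  rw [Int.abs_lt_one_iff] at this
  simp [this] at h0

lemma constant_on_arc_of_eventually_eq (x : UnitAddCircle) {a b : ℝ}
    (h : ∀ t ∈ Set.Ioo a b, ∀ᶠ y in 𝓝 (x + (t : UnitAddCircle)), f y = f (x + t))
    {s t : ℝ} (hs : s ∈ Set.Ioo a b) (ht : t ∈ Set.Ioo a b) :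
    f (x + (s : UnitAddCircle)) = f (x + (t : UnitAddCircle)) := by
  have hd : ∀ u ∈ Set.Ioo a b, HasDerivAt (fun t : ℝ => f (x + (t : UnitAddCircle))) 0 u := by
    intro u hu
    refine (hasDerivAt_const u (f (x + (u : UnitAddCircle)))).congr_of_eventuallyEq ?_
    exact (continuous_arc x).continuousAt.eventually (h u hu)
  exact isOpen_Ioo.is_const_of_deriv_eq_zero isPreconnected_Ioo
    (fun u hu => (hd u hu).differentiableAt.differentiableWithinAt)
    (fun u hu => (hd u hu).deriv) hs ht

lemma IsPiecewiseConstant.finite_range (hf : IsPiecewiseConstant f) : (Set.range f).Finite := by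
  obtain ⟨E, hE, hloc⟩ := hf
  rw [← Set.image_univ]
  refine isCompact_univ.induction_on (p := fun s => (f '' s).Finite) (by simp)
    (fun s t hst ht => ht.subset (Set.image_mono hst))
    (fun s t hs ht => by rw [Set.image_union]; exact hs.union ht) (fun z _ => ?_)
  have hV : ∀ᶠ t : ℝ in 𝓝 0, z + (t : UnitAddCircle) ∉ E \ {z} := by
    have hc : Tendsto (fun t : ℝ => z + (t : UnitAddCircle)) (𝓝 0) (𝓝 z) := by
      simpa using (continuous_arc z).tendsto 0
    refine hc.eventually (p := fun y => y ∉ E \ {z}) ?_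
    refine (hE.subset Set.sdiff_subset).isClosed.isOpen_compl.mem_nhds ?_
    simp
  obtain ⟨r, hr, hball⟩ := Metric.eventually_nhds_iff_ball.1 hV
  set r' := min r 1
  have hr' : 0 < r' := lt_min hr one_pos
  have hnotE : ∀ t : ℝ, |t| < r' → t ≠ 0 → z + (t : UnitAddCircle) ∉ E := by
    intro t ht h0 hmem
    refine hball t (by simpa using ht.trans_le (min_le_left _ _)) ⟨hmem, ?_⟩
    simp only [Set.mem_singleton_iff, add_eq_left]
    exact coe_circle_ne_zero h0 (ht.trans_le (min_le_right _ _))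
  refine ⟨(fun t : ℝ => z + (t : UnitAddCircle)) '' Set.Ioo (-r') r', ?_, ?_⟩
  · rw [nhdsWithin_univ]
    have hopen : IsOpenMap fun t : ℝ => z + (t : UnitAddCircle) :=
      (Homeomorph.addLeft z).isOpenMap.comp QuotientAddGroup.isOpenMap_coe
    refine (hopen _ isOpen_Ioo).mem_nhds ⟨0, ⟨by linarith, hr'⟩, by simp⟩
  · refine Set.Finite.subset (s := {f z, f (z + ((r' / 2 : ℝ) : UnitAddCircle)),
      f (z + ((-(r' / 2) : ℝ) : UnitAddCircle))}) (by simp) ?_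
    rintro _ ⟨_, ⟨t, ⟨ht1, ht2⟩, rfl⟩, rfl⟩
    simp only [Set.mem_insert_iff, Set.mem_singleton_iff]
    rcases lt_trichotomy t 0 with h | h | h
    · right; right
      refine constant_on_arc_of_eventually_eq z (a := -r') (b := 0) (fun u hu => ?_) ⟨ht1, h⟩
        ⟨by linarith, by linarith⟩
      exact hloc _ (hnotE u (by rw [abs_lt]; constructor <;> linarith [hu.1, hu.2]) hu.2.ne)
    · left; simp [h]
    · right; left
      refine constant_on_arc_of_eventually_eq z (a := 0) (b := r') (fun u hu => ?_) ⟨h, ht2⟩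
        ⟨by linarith, by linarith⟩
      exact hloc _ (hnotE u (by rw [abs_lt]; constructor <;> linarith [hu.1, hu.2]) hu.1.ne')

lemma IsPiecewiseConstant.finite_discontinuities (hf : IsPiecewiseConstant f) :
    (discontinuities f).Finite := by
  obtain ⟨E, hE, hloc⟩ := hf
  refine hE.subset fun x hx => ?_
  by_contra h
  exact hx (continuousAt_const.congr (EventuallyEq.symm (hloc x h)))

lemma IsPiecewiseConstant.measurable (hf : IsPiecewiseConstant f) : Measurable f := by
  refine measurable_of_isOpen fun U hU => ?_
  have : f ⁻¹' U = interior (f ⁻¹' U) ∪ (discontinuities f ∩ f ⁻¹' U) := by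
    ext x
    refine ⟨fun hx => ?_, fun hx => hx.elim (fun h => interior_subset h) fun h => h.2⟩
    by_cases hc : ContinuousAt f x
    · exact Or.inl (mem_interior_iff_mem_nhds.2 (hc (hU.mem_nhds hx)))
    · exact Or.inr ⟨hc, hx⟩
  rw [this]
  exact isOpen_interior.measurableSet.union
    ((hf.finite_discontinuities.subset Set.inter_subset_left).measurableSet)

lemma IsPiecewiseConstant.exists_bounds (hf : IsPiecewiseConstant f) (hpos : ∀ x, 0 < f x) :
    ∃ l u : ℝ, 0 < l ∧ 0 < u ∧ ∀ x, l ≤ f x ∧ f x ≤ u := by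
  have hfin := hf.finite_range
  obtain ⟨_, ⟨a, rfl⟩, ha⟩ := Set.exists_min_image _ id hfin (Set.range_nonempty f)
  obtain ⟨_, ⟨b, rfl⟩, hb⟩ := Set.exists_max_image _ id hfin (Set.range_nonempty f)
  exact ⟨f a, f b, hpos a, hpos b, fun x => ⟨ha _ ⟨x, rfl⟩, hb _ ⟨x, rfl⟩⟩⟩

/-- A piecewise constant function is constant along every arc without discontinuities. -/
lemma IsPiecewiseConstant.constant_on_arc (hf : IsPiecewiseConstant f) (x : UnitAddCircle)
    {S : Set ℝ} (hS : IsPreconnected S)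
    (h : ∀ t ∈ S, x + (t : UnitAddCircle) ∉ discontinuities f) {s t : ℝ} (hs : s ∈ S)
    (ht : t ∈ S) : f (x + (s : UnitAddCircle)) = f (x + (t : UnitAddCircle)) := by
  refine hS.constant_of_mapsTo (T := Set.range f) (f := fun t : ℝ => f (x + (t : UnitAddCircle)))
    hf.finite_range.isDiscrete (fun u hu => ?_) (fun u _ => ⟨_, rfl⟩) hs ht
  have hc : ContinuousAt f (x + (u : UnitAddCircle)) := not_not.1 (h u hu)
  exact (ContinuousAt.comp (f := fun t : ℝ => x + (t : UnitAddCircle)) hc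
    (continuous_arc x).continuousAt).continuousWithinAt

/-- The point `ξ` lies on the open arc of length `h` that starts at `x`. -/
def HitsArc (x : UnitAddCircle) (h : ℝ) (ξ : UnitAddCircle) : Prop :=
  ∃ t ∈ Set.Ioo 0 h, x + (t : UnitAddCircle) = ξ

/-- Short arcs contain at most one discontinuity. -/
lemma IsPiecewiseConstant.eventually_unique_discontinuity (hf : IsPiecewiseConstant f) :
    ∀ᶠ h : ℝ in 𝓝[>] 0, h < 1 ∧ ∀ (x : UnitAddCircle) (s t : ℝ), s ∈ Set.Icc 0 h →
      t ∈ Set.Icc 0 h → x + (s : UnitAddCircle) ∈ discontinuities f →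
      x + (t : UnitAddCircle) ∈ discontinuities f → s = t := by
  have hfin := hf.finite_discontinuities
  have h1 : ∀ᶠ h : ℝ in 𝓝[>] 0, h < 1 :=
    eventually_nhdsWithin_of_eventually_nhds (eventually_lt_nhds one_pos)
  have h2 : ∀ᶠ h : ℝ in 𝓝[>] 0, ∀ ξ ∈ discontinuities f, ∀ η ∈ discontinuities f,
      ξ ≠ η → h < ‖ξ - η‖ := by
    rw [eventually_all_finite hfin]
    intro ξ _
    rw [eventually_all_finite hfin]
    intro η _
    by_cases hne : ξ = η
    · simp [hne]
    · filter_upwards [eventually_nhdsWithin_of_eventually_nhds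
        (eventually_lt_nhds (norm_pos_iff.2 (sub_ne_zero.2 hne)))] with h hh _ using hh
  filter_upwards [h1, h2] with h hh1 hh2
  refine ⟨hh1, fun x s t hs ht hxs hxt => ?_⟩
  have habs : |s - t| ≤ h := by rw [abs_le]; constructor <;> linarith [hs.1, hs.2, ht.1, ht.2]
  have heq : x + (s : UnitAddCircle) = x + (t : UnitAddCircle) := by
    by_contra hne
    have h3 := hh2 _ hxs _ hxt hne
    have h4 : x + (s : UnitAddCircle) - (x + (t : UnitAddCircle)) = ((s - t : ℝ) : UnitAddCircle) := by
      rw [AddCircle.coe_sub]; abel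
    rw [h4] at h3
    linarith [norm_coe_circle_le (s - t)]
  by_contra hne
  refine coe_circle_ne_zero (sub_ne_zero.2 hne) (habs.trans_lt hh1) ?_
  rw [AddCircle.coe_sub, sub_eq_zero]
  exact add_left_cancel heq

lemma IsPiecewiseConstant.jump_eq (hf : IsPiecewiseConstant f) (x : UnitAddCircle) {t h : ℝ}
    (ht : t ∈ Set.Ioo 0 h)
    (huniq : ∀ s ∈ Set.Icc 0 h, x + (s : UnitAddCircle) ∈ discontinuities f → s = t) :
    jump f (x + (t : UnitAddCircle)) = f x - f (x + (h : UnitAddCircle)) := by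
  have hleft : Tendsto (fun s : ℝ => f (x + (t : UnitAddCircle) + (s : UnitAddCircle))) (𝓝[<] 0)
      (𝓝 (f x)) := by
    refine tendsto_const_nhds.congr' ?_
    filter_upwards [Ioo_mem_nhdsLT (show -t < 0 by linarith [ht.1])] with s hs
    have := hf.constant_on_arc x (S := Set.Ico 0 t) isPreconnected_Ico (fun u hu hd =>
      hu.2.ne (huniq u ⟨hu.1, by linarith [hu.2, ht.2]⟩ hd)) (s := 0) (t := t + s)
      ⟨le_rfl, ht.1⟩ ⟨by linarith [hs.1], by linarith [hs.2]⟩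
    rw [add_assoc, ← AddCircle.coe_add, ← this]
    simp
  have hright : Tendsto (fun s : ℝ => f (x + (t : UnitAddCircle) + (s : UnitAddCircle))) (𝓝[>] 0)
      (𝓝 (f (x + (h : UnitAddCircle)))) := by
    refine tendsto_const_nhds.congr' ?_
    filter_upwards [Ioo_mem_nhdsGT (show 0 < h - t by linarith [ht.2])] with s hs
    have := hf.constant_on_arc x (S := Set.Ioc t h) isPreconnected_Ioc (fun u hu hd =>
      hu.1.ne' (huniq u ⟨by linarith [hu.1, ht.1], hu.2⟩ hd)) (s := h) (t := t + s)
      ⟨ht.2, le_rfl⟩ ⟨by linarith [hs.1], by linarith [hs.2]⟩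
    rw [add_assoc, ← AddCircle.coe_add, ← this]
  rw [jump, hleft.limUnder_eq, hright.limUnder_eq]

open Classical in
/-- Along a short arc with good end points the function changes by minus the jumps on the arc. -/
lemma IsPiecewiseConstant.eventually_sub_eq_sum_jump (hf : IsPiecewiseConstant f) :
    ∀ᶠ h : ℝ in 𝓝[>] 0, ∀ x : UnitAddCircle, x ∉ discontinuities f →
      x + (h : UnitAddCircle) ∉ discontinuities f →
      f (x + (h : UnitAddCircle)) - f x =
        -∑ ξ ∈ hf.finite_discontinuities.toFinset, if HitsArc x h ξ then jump f ξ else 0 := by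
  filter_upwards [hf.eventually_unique_discontinuity, self_mem_nhdsWithin] with h hh hpos x hx hxh
  replace hpos : 0 < h := hpos
  by_cases hex : ∃ ξ ∈ discontinuities f, HitsArc x h ξ
  · obtain ⟨ξ, hξ, t, ht, rfl⟩ := hex
    have huniq : ∀ s ∈ Set.Icc 0 h, x + (s : UnitAddCircle) ∈ discontinuities f → s = t :=
      fun s hs hd => hh.2 x s t hs ⟨ht.1.le, ht.2.le⟩ hd hξ
    rw [Finset.sum_eq_single (x + (t : UnitAddCircle))]
    · rw [if_pos ⟨t, ht, rfl⟩, hf.jump_eq x ht huniq]; ring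
    · intro η hη hne
      rw [if_neg]
      rintro ⟨s, hs, rfl⟩
      rw [Set.Finite.mem_toFinset] at hη
      exact hne (by rw [huniq s ⟨hs.1.le, hs.2.le⟩ hη])
    · intro hmem
      exact absurd ((Set.Finite.mem_toFinset _).2 hξ) hmem
  · push Not at hex
    rw [Finset.sum_eq_zero fun ξ hξ => if_neg (hex ξ ((Set.Finite.mem_toFinset _).1 hξ))]
    have := hf.constant_on_arc x (S := Set.Icc 0 h) isPreconnected_Icc (fun t ht hd => ?_)
      (s := h) (t := 0) ⟨hpos.le, le_rfl⟩ ⟨le_rfl, hpos.le⟩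
    · rw [this]; simp
    · rcases eq_or_lt_of_le ht.1 with h0 | h0
      · rw [← h0] at hd; simp at hd; exact hx hd
      rcases eq_or_lt_of_le ht.2 with h1 | h1
      · rw [h1] at hd; exact hxh hd
      · exact hex _ hd ⟨t, ⟨h0, h1⟩, rfl⟩

end PiecewiseConstant

/-! ### Separation of the hitting times -/

lemma coe_zsmul_circle (k : ℤ) (β : ℝ) :
    k • (β : UnitAddCircle) = ((k * β : ℝ) : UnitAddCircle) := by
  rw [← AddCircle.coe_zsmul, zsmul_eq_mul]

lemma coe_circleRep (ξ : UnitAddCircle) : ((circleRep ξ : ℝ) : UnitAddCircle) = ξ :=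
  (AddCircle.equivIco (1 : ℝ) 0).symm_apply_apply ξ

lemma InRatSpan.neg {α x : ℝ} (h : InRatSpan α x) : InRatSpan (-α) x := by
  obtain ⟨r, s, h⟩ := h
  exact ⟨r, -s, by rw [h]; push_cast; ring⟩

lemma InIntSpan.neg {α x : ℝ} (h : InIntSpan α x) : InIntSpan (-α) x := by
  obtain ⟨r, s, h⟩ := h
  exact ⟨r, -s, by rw [h]; push_cast; ring⟩

lemma PropertyP1.neg {α : ℝ} {f : UnitAddCircle → ℝ} (h : PropertyP1 α f) :
    PropertyP1 (-α) f := by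
  intro n hn h0 hsum
  obtain ⟨ξ, hξ, η, hη, hne, hr, hi⟩ := h n hn h0 hsum
  exact ⟨ξ, hξ, η, hη, hne, hr.neg, fun h' => hi (by simpa using h'.neg)⟩

lemma HitsArc.exists_circleRep_sub_eq {x ξ η : UnitAddCircle} {β h : ℝ} {k k' : ℤ}
    (h1 : HitsArc (x + k • (β : UnitAddCircle)) h ξ)
    (h2 : HitsArc (x + k' • (β : UnitAddCircle)) h η) :
    ∃ (τ : ℝ) (m : ℤ), |τ| < h ∧
      circleRep ξ - circleRep η = ((k - k' : ℤ) : ℝ) * β + τ + m := by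
  obtain ⟨t, ht, hξ⟩ := h1
  obtain ⟨t', ht', hη⟩ := h2
  have h3 : ((circleRep ξ - circleRep η - (((k - k' : ℤ) : ℝ) * β + (t - t')) : ℝ) :
      UnitAddCircle) = 0 := by
    push_cast
    simp only [AddCircle.coe_sub, AddCircle.coe_add, coe_circleRep, sub_mul]
    rw [← coe_zsmul_circle, ← coe_zsmul_circle, ← hξ, ← hη]
    abel
  obtain ⟨m, hm⟩ := coe_circle_eq_zero_iff.1 h3
  refine ⟨t - t', m, ?_, by linarith⟩
  rw [abs_lt]; constructor <;> linarith [ht.1, ht.2, ht'.1, ht'.2]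

lemma HitsArc.le_abs_sub_mul {x ξ : UnitAddCircle} {β c h : ℝ} (hβ : IsBadlyApproximable β c)
    {k k' : ℤ} (h1 : HitsArc (x + k • (β : UnitAddCircle)) h ξ)
    (h2 : HitsArc (x + k' • (β : UnitAddCircle)) h ξ) (hne : k ≠ k') :
    c ≤ |((k - k' : ℤ) : ℝ)| * h := by
  obtain ⟨τ, m, hτ, heq⟩ := h1.exists_circleRep_sub_eq h2
  have h3 := hβ.2 (k - k') (sub_ne_zero.2 hne) (-m)
  have h4 : |((k - k' : ℤ) : ℝ) * β - ((-m : ℤ) : ℝ)| = |τ| := by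
    rw [← abs_neg τ]; congr 1; push_cast at heq ⊢; linarith
  rw [h4] at h3
  exact h3.trans (by gcongr)

/-- If `ξ - η = (A + B β) / m` is not in `ℤ + ℤβ`, then the times at which short arcs meet `ξ` and
`η` are far apart: a time difference `k` gives `|(B - m k) β + integer| < m h`, and the integer
`B - m k` can only vanish when `ξ - η ∈ ℤ + ℤβ`. -/
lemma IsBadlyApproximable.eventually_separated {β c : ℝ} (hβ : IsBadlyApproximable β c)
    {ξ η : UnitAddCircle} (hr : InRatSpan β (circleRep ξ - circleRep η))
    (hi : ¬ InIntSpan β (circleRep ξ - circleRep η)) :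
    ∀ᶠ c' : ℝ in 𝓝[>] 0, ∀ᶠ h : ℝ in 𝓝[>] 0, ∀ (x : UnitAddCircle) (k k' : ℤ),
      HitsArc (x + k • (β : UnitAddCircle)) h ξ → HitsArc (x + k' • (β : UnitAddCircle)) h η →
      c' ≤ |((k - k' : ℤ) : ℝ)| * h := by
  obtain ⟨r, s, hrs⟩ := hr
  obtain ⟨hc, hba⟩ := hβ
  obtain ⟨m, A, B, hm, hA, hB⟩ : ∃ m A B : ℤ, 0 < m ∧ (m : ℝ) * r = A ∧ (m : ℝ) * s = B := by
    refine ⟨r.den * s.den, r.num * s.den, s.num * r.den, by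
      have := r.pos; have := s.pos; positivity, ?_, ?_⟩
    · rw [Rat.cast_def r]; push_cast
      have : (r.den : ℝ) ≠ 0 := by exact_mod_cast r.den_ne_zero
      field_simp
    · rw [Rat.cast_def s]; push_cast
      have : (s.den : ℝ) ≠ 0 := by exact_mod_cast s.den_ne_zero
      field_simp
  have hm' : (0 : ℝ) < m := by exact_mod_cast hm
  have hm1 : (1 : ℝ) ≤ m := by exact_mod_cast hm
  have e1 : ∀ᶠ c' : ℝ in 𝓝[>] 0, c' < c / (2 * m ^ 2) :=
    eventually_nhdsWithin_of_eventually_nhds (eventually_lt_nhds (by positivity))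
  filter_upwards [e1] with c' hc'
  have e2 : ∀ᶠ h : ℝ in 𝓝[>] 0, h < 1 / m :=
    eventually_nhdsWithin_of_eventually_nhds (eventually_lt_nhds (by positivity))
  have e3 : ∀ᶠ h : ℝ in 𝓝[>] 0, h < c / (2 * m * (|(B : ℝ)| + 1)) :=
    eventually_nhdsWithin_of_eventually_nhds (eventually_lt_nhds (by positivity))
  filter_upwards [e2, e3, self_mem_nhdsWithin] with h h1 h2 h0 x k k' hk hk'
  replace h0 : 0 < h := h0
  obtain ⟨τ, z, hτ, heq⟩ := hk.exists_circleRep_sub_eq hk'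
  have hmτ : (m : ℝ) * τ = A - m * z + (B - m * ((k - k' : ℤ) : ℝ)) * β := by
    have : (m : ℝ) * (r + s * β) = m * (((k - k' : ℤ) : ℝ) * β + τ + z) := by rw [← hrs, heq]
    linear_combination -this + hA + β * hB
  by_cases hq : B - m * (k - k') = 0
  · exfalso
    have hq' : (B : ℝ) - m * ((k - k' : ℤ) : ℝ) = 0 := by exact_mod_cast hq
    rw [hq', zero_mul, add_zero] at hmτ
    have h3 : |(m : ℝ) * τ| < 1 := by
      rw [abs_mul, abs_of_pos hm']
      calc (m : ℝ) * |τ| < m * (1 / m) := by gcongr; linarith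
        _ = 1 := by field_simp
    rw [hmτ] at h3
    have h4 : |A - m * z| < 1 := by exact_mod_cast h3
    rw [Int.abs_lt_one_iff] at h4
    have h5 : (A : ℝ) - m * z = 0 := by exact_mod_cast h4
    rw [h5] at hmτ
    have h6 : τ = 0 := by simpa [hm'.ne'] using hmτ
    exact hi ⟨z, k - k', by rw [heq, h6]; ring⟩
  · have h3 := hba _ hq (-(A - m * z))
    have h4 : |((B - m * (k - k') : ℤ) : ℝ) * β - ((-(A - m * z) : ℤ) : ℝ)| = |(m : ℝ) * τ| := by
      rw [hmτ]; congr 1; push_cast; ring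
    rw [h4, abs_mul, abs_of_pos hm'] at h3
    set K : ℝ := ((k - k' : ℤ) : ℝ)
    have h5 : |((B - m * (k - k') : ℤ) : ℝ)| ≤ |(B : ℝ)| + m * |K| := by
      have : ((B - m * (k - k') : ℤ) : ℝ) = B - m * K := by simp only [K]; push_cast; ring
      rw [this, ← abs_of_pos hm', ← abs_mul, abs_of_pos hm']
      exact abs_sub _ _
    have h6 : c ≤ (|(B : ℝ)| + m * |K|) * (m * h) := by
      refine h3.trans ?_
      gcongr
    rw [lt_div_iff₀ (by positivity)] at h2
    rw [lt_div_iff₀ (by positivity)] at hc'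
    have h8 : (m : ℝ) * h > 0 := by positivity
    by_contra hcon
    push Not at hcon
    have : m ^ 2 * (|K| * h) < m ^ 2 * c' := by gcongr
    nlinarith

/-- One constant that separates all the hitting times which have to be separated. -/
lemma IsPiecewiseConstant.exists_separated {f : UnitAddCircle → ℝ} (hf : IsPiecewiseConstant f)
    {β c : ℝ} (hβ : IsBadlyApproximable β c) :
    ∃ c' : ℝ, 0 < c' ∧ ∀ᶠ h : ℝ in 𝓝[>] 0, ∀ (x : UnitAddCircle) (k k' : ℤ),
      ∀ ξ ∈ discontinuities f, ∀ η ∈ discontinuities f,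
      HitsArc (x + k • (β : UnitAddCircle)) h ξ → HitsArc (x + k' • (β : UnitAddCircle)) h η →
      (ξ = η ∧ k ≠ k') ∨ (InRatSpan β (circleRep ξ - circleRep η) ∧
        ¬ InIntSpan β (circleRep ξ - circleRep η)) →
      c' ≤ |((k - k' : ℤ) : ℝ)| * h := by
  have hfin := hf.finite_discontinuities
  have h1 : ∀ᶠ c' : ℝ in 𝓝[>] 0, ∀ ξ ∈ discontinuities f, ∀ η ∈ discontinuities f,
      ∀ᶠ h : ℝ in 𝓝[>] 0, ∀ (x : UnitAddCircle) (k k' : ℤ),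
      HitsArc (x + k • (β : UnitAddCircle)) h ξ → HitsArc (x + k' • (β : UnitAddCircle)) h η →
      (InRatSpan β (circleRep ξ - circleRep η) ∧ ¬ InIntSpan β (circleRep ξ - circleRep η)) →
      c' ≤ |((k - k' : ℤ) : ℝ)| * h := by
    rw [eventually_all_finite hfin]
    intro ξ _
    rw [eventually_all_finite hfin]
    intro η _
    by_cases hrel : InRatSpan β (circleRep ξ - circleRep η) ∧
        ¬ InIntSpan β (circleRep ξ - circleRep η)
    · filter_upwards [hβ.eventually_separated hrel.1 hrel.2] with c' hc'
      filter_upwards [hc'] with h hh x k k' hk hk' _ using hh x k k' hk hk'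
    · exact Eventually.of_forall fun c' => Eventually.of_forall fun h x k k' _ _ hr =>
        absurd hr hrel
  have h2 : ∀ᶠ c' : ℝ in 𝓝[>] 0, c' < c :=
    eventually_nhdsWithin_of_eventually_nhds (eventually_lt_nhds hβ.1)
  obtain ⟨c', ⟨hc1, hc2⟩, hc0⟩ := ((h1.and h2).and self_mem_nhdsWithin).exists
  refine ⟨c', hc0, ?_⟩
  have h3 : ∀ᶠ h : ℝ in 𝓝[>] 0, ∀ ξ ∈ discontinuities f, ∀ η ∈ discontinuities f,
      ∀ (x : UnitAddCircle) (k k' : ℤ),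
      HitsArc (x + k • (β : UnitAddCircle)) h ξ → HitsArc (x + k' • (β : UnitAddCircle)) h η →
      (InRatSpan β (circleRep ξ - circleRep η) ∧ ¬ InIntSpan β (circleRep ξ - circleRep η)) →
      c' ≤ |((k - k' : ℤ) : ℝ)| * h := by
    rw [eventually_all_finite hfin]
    intro ξ hξ
    rw [eventually_all_finite hfin]
    intro η hη
    exact hc1 ξ hξ η hη
  filter_upwards [h3] with h hh x k k' ξ hξ η hη hk hk' hor
  rcases hor with ⟨rfl, hne⟩ | hrel
  · exact hc2.le.trans (hk.le_abs_sub_mul hβ hk' hne)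
  · exact hh ξ hξ η hη x k k' hk hk' hrel

/-! ### The drift of two nearby points -/

open Classical in
/-- The pigeonhole argument. Suppose that each of the points of `Ξ` is hit at most once in any
window of length `(#Ξ + 1) w`. Of the `#Ξ + 1` consecutive blocks of length `w` after the first hit
one contains no hit, and along that block the accumulated weight is constant. -/
lemma exists_constant_block {ι : Type*} (Ξ : Finset ι) (d : ι → ℝ) (hit : ℕ → ι → Prop)
    (k₁ w : ℕ) (hfirst : ∃ ξ ∈ Ξ, hit k₁ ξ) (hmin : ∀ k < k₁, ∀ ξ ∈ Ξ, ¬ hit k ξ)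
    (hsep : ∀ ξ ∈ Ξ, ∀ k k' : ℕ, k < k' → hit k ξ → hit k' ξ → k + (Ξ.card + 1) * w < k') :
    ∃ a : ℕ, a + w ≤ k₁ + (Ξ.card + 1) * w + 1 ∧ ∃ S ⊆ Ξ, S.Nonempty ∧
      (∀ ξ ∈ S, ∃ k, k₁ ≤ k ∧ k ≤ k₁ + (Ξ.card + 1) * w ∧ hit k ξ) ∧
      ∀ n, a ≤ n → n ≤ a + w →
        ∑ k ∈ Finset.range n, ∑ ξ ∈ Ξ, (if hit k ξ then d ξ else 0) = ∑ ξ ∈ S, d ξ := by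
  obtain ⟨j, hj, hfree⟩ : ∃ j ≤ Ξ.card, ∀ k, k₁ + j * w < k → k ≤ k₁ + (j + 1) * w →
      ∀ ξ ∈ Ξ, ¬ hit k ξ := by
    have : Nonempty ι := ⟨hfirst.choose⟩
    by_contra! hcon
    choose! k hk1 hk2 ξ hξ hhit using hcon
    obtain ⟨i, hi, j, hj, hne, heq⟩ := Finset.exists_ne_map_eq_of_card_lt_of_maps_to
      (s := Finset.range (Ξ.card + 1)) (t := Ξ) (f := ξ) (by simp)
      (fun j hj => hξ j (by simp at hj; omega))
    have aux : ∀ i j, i ≤ Ξ.card → j ≤ Ξ.card → i < j → ξ i = ξ j → False := by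
      intro i j hi hj hij heq
      have h1 : (i + 1) * w ≤ j * w := Nat.mul_le_mul_right _ hij
      have h2 : (j + 1) * w ≤ (Ξ.card + 1) * w := Nat.mul_le_mul_right _ (by omega)
      have h3 := hk2 i hi
      have h4 := hk1 j hj
      have h5 := hsep _ (hξ i hi) (k i) (k j) (by omega) (hhit i hi) (heq ▸ hhit j hj)
      have h6 := hk1 i hi
      have h7 := hk2 j hj
      omega
    simp only [Finset.mem_range] at hi hj
    rcases lt_or_gt_of_ne hne with h | h
    · exact aux i j (by omega) (by omega) h heq
    · exact aux j i (by omega) (by omega) h heq.symm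
  have h1 : (j + 1) * w ≤ (Ξ.card + 1) * w := Nat.mul_le_mul_right _ (by omega)
  have h2 : (j + 1) * w = j * w + w := by ring
  refine ⟨k₁ + j * w + 1, by omega, Ξ.filter fun ξ => ∃ k, k < k₁ + j * w + 1 ∧ hit k ξ,
    Finset.filter_subset _ _, ?_, ?_, ?_⟩
  · obtain ⟨ξ, hξ, hh⟩ := hfirst
    exact ⟨ξ, Finset.mem_filter.2 ⟨hξ, k₁, by omega, hh⟩⟩
  · intro ξ hξ
    obtain ⟨hξ, k, hk, hh⟩ := Finset.mem_filter.1 hξ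
    refine ⟨k, ?_, by omega, hh⟩
    by_contra hlt
    exact hmin k (by omega) ξ hξ hh
  · intro n hn1 hn2
    rw [Finset.sum_comm, Finset.sum_filter]
    refine Finset.sum_congr rfl fun ξ hξ => ?_
    split_ifs with hex
    · obtain ⟨k, hk, hh⟩ := hex
      rw [Finset.sum_eq_single k, if_pos hh]
      · intro k' hk' hne
        rw [if_neg]
        intro hh'
        have hge : ∀ i, hit i ξ → k₁ ≤ i := fun i hi => by
          by_contra hlt
          exact hmin i (by omega) ξ hξ hi
        have := hge k hh
        have := hge k' hh'
        simp only [Finset.mem_range] at hk'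
        rcases lt_or_gt_of_ne hne with h | h
        · have := hsep ξ hξ _ _ h hh' hh
          omega
        · have := hsep ξ hξ _ _ h hh hh'
          omega
      · intro hk'
        simp only [Finset.mem_range] at hk'
        omega
    · refine Finset.sum_eq_zero fun k hk => if_neg fun hh => ?_
      simp only [Finset.mem_range] at hk
      by_cases hka : k < k₁ + j * w + 1
      · exact hex ⟨k, hka, hh⟩
      · exact hfree k (by omega) (by omega) ξ hξ hh

open Classical in
/-- The possible drifts: the non-zero numbers `± ∑_{ξ ∈ S} d(ξ)` with `S` a set of
discontinuities. -/
def driftSet (Ξ : Finset UnitAddCircle) (f : UnitAddCircle → ℝ) : Finset ℝ :=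
  (Ξ.powerset.image (fun S => ∑ ξ ∈ S, jump f ξ) ∪
    Ξ.powerset.image (fun S => -∑ ξ ∈ S, jump f ξ)).erase 0

lemma neg_mem_driftSet {Ξ : Finset UnitAddCircle} {f : UnitAddCircle → ℝ} {ρ : ℝ}
    (h : ρ ∈ driftSet Ξ f) : -ρ ∈ driftSet Ξ f := by
  classical
  simp only [driftSet, Finset.mem_erase, Finset.mem_union, Finset.mem_image] at h ⊢
  refine ⟨neg_ne_zero.2 h.1, ?_⟩
  rcases h.2 with ⟨S, hS, rfl⟩ | ⟨S, hS, rfl⟩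
  · exact Or.inr ⟨S, hS, rfl⟩
  · exact Or.inl ⟨S, hS, by simp⟩

/-- A set of discontinuities with vanishing sum of jumps contains a pair as in (P1), whose hitting
times are separated. -/
lemma PropertyP1.exists_pair {β : ℝ} {f : UnitAddCircle → ℝ} (hP1 : PropertyP1 β f)
    {S : Finset UnitAddCircle} (hS : (S : Set UnitAddCircle) ⊆ discontinuities f)
    (hne : S.Nonempty) (hsum : ∑ ξ ∈ S, jump f ξ = 0) :
    ∃ ξ ∈ S, ∃ η ∈ S, InRatSpan β (circleRep ξ - circleRep η) ∧
      ¬ InIntSpan β (circleRep ξ - circleRep η) := by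
  classical
  set n : UnitAddCircle →₀ ℤ := Finsupp.indicator S fun _ _ => 1
  have hval : ∀ ξ ∈ S, n ξ = 1 := fun ξ hξ => Finsupp.indicator_of_mem hξ _
  have hsupp : n.support = S := by
    refine Finset.Subset.antisymm (Finsupp.support_indicator_subset _ _) fun ξ hξ => ?_
    rw [Finsupp.mem_support_iff, hval ξ hξ]
    exact one_ne_zero
  obtain ⟨ξ, hξ, η, hη, -, hr⟩ := hP1 n (by rwa [hsupp]) (by
    rw [← Finsupp.support_nonempty_iff, hsupp]; exact hne) (by
    rw [hsupp, ← hsum]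
    exact Finset.sum_congr rfl fun ξ hξ => by rw [hval ξ hξ]; simp)
  rw [hsupp] at hξ hη
  exact ⟨ξ, hξ, η, hη, hr⟩

/-- The one-sided drift: the ergodic sums at two points at distance `h` differ by a constant
non-zero `ρ` along a block of times of length and position comparable to `1 / h`. -/
lemma IsPiecewiseConstant.exists_drift {f : UnitAddCircle → ℝ} (hf : IsPiecewiseConstant f)
    (hdisc : (discontinuities f).Nonempty) {β c : ℝ} (hβ : IsBadlyApproximable β c)
    (hP1 : PropertyP1 β f) :
    ∃ c' C : ℝ, 0 < c' ∧ ∀ᶠ h : ℝ in 𝓝[>] 0, ∀ x : UnitAddCircle,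
      (∀ k : ℕ, x + (k : ℤ) • (β : UnitAddCircle) ∉ discontinuities f ∧
        x + (k : ℤ) • (β : UnitAddCircle) + (h : UnitAddCircle) ∉ discontinuities f) →
      ∃ a w : ℕ, c' ≤ w * h ∧ c' ≤ a * h ∧ (a + w) * h ≤ C ∧
        ∃ ρ ∈ driftSet hf.finite_discontinuities.toFinset f, ∀ n : ℕ, a ≤ n → n ≤ a + w →
          ∑ k ∈ Finset.range n, (f (x + (k : ℤ) • (β : UnitAddCircle) + (h : UnitAddCircle)) -
            f (x + (k : ℤ) • (β : UnitAddCircle))) = ρ := by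
  classical
  obtain ⟨C, hC, hcov⟩ := hβ.exists_hit
  obtain ⟨c₁, hc₁, hsep⟩ := hf.exists_separated hβ
  set Ξ := hf.finite_discontinuities.toFinset with hΞ
  have hmem : ∀ ξ, ξ ∈ Ξ ↔ ξ ∈ discontinuities f := fun ξ => Set.Finite.mem_toFinset _
  set p : ℝ := (Ξ.card : ℝ) + 1
  have hp : 1 ≤ p := by simp [p]
  set c₂ : ℝ := c₁ / (4 * p) with hc₂
  have hc₂pos : 0 < c₂ := by positivity
  have hc₂' : c₁ / 2 = p * (2 * c₂) := by rw [hc₂]; field_simp; norm_num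
  refine ⟨c₂ / 4, C + c₁ + 1, by positivity, ?_⟩
  filter_upwards [hsep, hf.eventually_sub_eq_sum_jump,
    eventually_nhdsWithin_of_eventually_nhds (eventually_lt_nhds one_pos),
    eventually_nhdsWithin_of_eventually_nhds (eventually_lt_nhds (by positivity : 0 < c₂ / 4)),
    self_mem_nhdsWithin] with h hsep hjump h1 hhc h0 x hx
  replace h0 : 0 < h := h0
  set hit : ℕ → UnitAddCircle → Prop := fun k ξ =>
    HitsArc (x + (k : ℤ) • (β : UnitAddCircle)) h ξ
  obtain ⟨k₀, hk₀, hhit₀⟩ : ∃ k : ℕ, (k : ℝ) ≤ C / h ∧ ∃ ξ ∈ Ξ, hit k ξ := by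
    obtain ⟨ξ, hξ⟩ := hdisc
    obtain ⟨k, hk, m, t, ht, hm⟩ := hcov h h0 h1 (circleRep (x - ξ))
    refine ⟨k, hk, ξ, (hmem ξ).2 hξ, t, ht, ?_⟩
    have h3 := congrArg (fun r : ℝ => (r : UnitAddCircle)) hm
    simp only [AddCircle.coe_add, coe_circleRep] at h3
    rw [coe_circle_eq_zero_iff.2 ⟨m, rfl⟩] at h3
    rw [coe_zsmul_circle, Int.cast_natCast, ← sub_eq_zero, ← h3]
    abel
  have hex : ∃ k : ℕ, ∃ ξ ∈ Ξ, hit k ξ := ⟨k₀, hhit₀⟩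
  set k₁ := Nat.find hex
  have hk₁ : (k₁ : ℝ) * h ≤ C := by
    rw [← le_div_iff₀ h0]
    exact le_trans (by exact_mod_cast Nat.find_min' hex hhit₀) hk₀
  -- `#Ξ + 1` blocks of this length together stay within the separation time `c₁ / h`
  set w : ℕ := ⌊2 * c₂ / h⌋₊
  have hw1 : (w : ℝ) * h ≤ 2 * c₂ := by
    rw [← le_div_iff₀ h0]; exact Nat.floor_le (by positivity)
  have hw2 : 2 * c₂ - h ≤ w * h := by
    have := Nat.lt_floor_add_one (2 * c₂ / h)
    rw [div_lt_iff₀ h0] at this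
    change 2 * c₂ < ((w : ℝ) + 1) * h at this
    linarith
  have hpw : (((Ξ.card + 1) * w : ℕ) : ℝ) * h < c₁ := by
    push_cast
    have : p * (w * h) ≤ p * (2 * c₂) := by gcongr
    calc _ = p * (w * h) := by simp only [p]; ring
      _ ≤ p * (2 * c₂) := this
      _ < c₁ := by linarith
  obtain ⟨a, ha, S, hSΞ, hSne, hShit, hSsum⟩ := exists_constant_block Ξ (jump f) hit k₁ w
    (Nat.find_spec hex) (fun k hk ξ hξ hh => Nat.find_min hex hk ⟨ξ, hξ, hh⟩)
    (fun ξ hξ k k' hlt hk hk' => by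
      have h2 := hsep x k k' ξ ((hmem ξ).1 hξ) ξ ((hmem ξ).1 hξ) hk hk'
        (Or.inl ⟨rfl, by exact_mod_cast hlt.ne⟩)
      have h3 : |(((k : ℤ) - (k' : ℤ) : ℤ) : ℝ)| = (k' : ℝ) - k := by
        have : (k : ℝ) < k' := by exact_mod_cast hlt
        push_cast; rw [abs_sub_comm, abs_of_pos (by linarith)]
      rw [h3] at h2
      have h4 : (((Ξ.card + 1) * w : ℕ) : ℝ) < k' - k :=
        lt_of_mul_lt_mul_right (hpw.trans_le h2) h0.le
      have h5 : ((k + (Ξ.card + 1) * w : ℕ) : ℝ) < k' := by push_cast at h4 ⊢; linarith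
      exact_mod_cast h5)
  have hne0 : ∑ ξ ∈ S, jump f ξ ≠ 0 := by
    intro hzero
    obtain ⟨ξ, hξ, η, hη, hrel⟩ := hP1.exists_pair
      (fun ξ hξ => (hmem ξ).1 (hSΞ hξ)) hSne hzero
    obtain ⟨k, hk1, hk2, hk⟩ := hShit ξ hξ
    obtain ⟨k', hk1', hk2', hk'⟩ := hShit η hη
    have h2 := hsep x k k' ξ ((hmem ξ).1 (hSΞ hξ)) η ((hmem η).1 (hSΞ hη)) hk hk' (Or.inr hrel)
    have h3 : |(((k : ℤ) - (k' : ℤ) : ℤ) : ℝ)| ≤ (((Ξ.card + 1) * w : ℕ) : ℝ) := by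
      have : |(k : ℤ) - (k' : ℤ)| ≤ (((Ξ.card + 1) * w : ℕ) : ℤ) := by
        rw [abs_le]; constructor <;> omega
      exact_mod_cast this
    have h4 : |(((k : ℤ) - (k' : ℤ) : ℤ) : ℝ)| * h ≤ (((Ξ.card + 1) * w : ℕ) : ℝ) * h := by gcongr
    linarith
  -- passing to the second half of the block makes its starting point large
  have hw4 : 4 * (w / 2) + 2 ≥ 2 * w := by omega
  have hw5 : (2 : ℝ) * w ≤ 4 * ((w / 2 : ℕ) : ℝ) + 2 := by exact_mod_cast hw4
  have hw6 : c₂ / 4 ≤ ((w / 2 : ℕ) : ℝ) * h := by nlinarith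
  refine ⟨a + w / 2, w / 2, hw6, ?_, ?_, -∑ ξ ∈ S, jump f ξ, ?_, ?_⟩
  · push_cast
    have : 0 ≤ (a : ℝ) * h := by positivity
    linarith [add_mul (a : ℝ) ((w / 2 : ℕ) : ℝ) h]
  · have h2 : a + w / 2 + w / 2 ≤ k₁ + (Ξ.card + 1) * w + 1 := by omega
    have h3 : ((a + w / 2 : ℕ) : ℝ) + ((w / 2 : ℕ) : ℝ) ≤
        k₁ + (((Ξ.card + 1) * w : ℕ) : ℝ) + 1 := by exact_mod_cast h2
    calc _ ≤ ((k₁ : ℝ) + (((Ξ.card + 1) * w : ℕ) : ℝ) + 1) * h := by gcongr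
      _ = k₁ * h + (((Ξ.card + 1) * w : ℕ) : ℝ) * h + h := by ring
      _ ≤ _ := by linarith
  · simp only [driftSet, Finset.mem_erase, Finset.mem_union, Finset.mem_image]
    exact ⟨neg_ne_zero.2 hne0, Or.inr ⟨S, Finset.mem_powerset.2 hSΞ, rfl⟩⟩
  · intro n hn1 hn2
    rw [← hSsum n (by omega) (by omega), ← Finset.sum_neg_distrib]
    exact Finset.sum_congr rfl fun k _ => hjump _ (hx k).1 (hx k).2

lemma rotationCocycle_natCast (α : ℝ) (f : UnitAddCircle → ℝ) (n : ℕ) (x : UnitAddCircle) :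
    rotationCocycle α f n x = ∑ k ∈ Finset.range n, f (x + (k : ℤ) • (α : UnitAddCircle)) := by
  induction n with
  | zero => simp [rotationCocycle]
  | succ n ih =>
    rw [Nat.cast_succ, rotationCocycle_succ, ih, Finset.sum_range_succ]

lemma rotationCocycle_neg_natCast (α : ℝ) (f : UnitAddCircle → ℝ) (n : ℕ) (x : UnitAddCircle) :
    rotationCocycle α f (-n) x = -∑ k ∈ Finset.range n,
      f (x - (α : UnitAddCircle) + (k : ℤ) • ((-α : ℝ) : UnitAddCircle)) := by
  induction n with
  | zero => simp [rotationCocycle]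
  | succ n ih =>
    have h := rotationCocycle_succ α f (-((n : ℤ) + 1)) x
    rw [show -((n : ℤ) + 1) + 1 = -n by ring, ih] at h
    rw [Finset.sum_range_succ, Nat.cast_succ]
    have h2 : x - (α : UnitAddCircle) + (n : ℤ) • ((-α : ℝ) : UnitAddCircle) =
        x + (-((n : ℤ) + 1)) • (α : UnitAddCircle) := by
      rw [AddCircle.coe_neg, neg_smul, add_smul, one_smul, smul_neg]; abel
    rw [h2]
    linarith

lemma exists_abs_eq_norm (z : UnitAddCircle) : ∃ r : ℝ, (r : UnitAddCircle) = z ∧ |r| = ‖z‖ := by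
  refine ⟨circleRep z - round (circleRep z), ?_, ?_⟩
  · rw [AddCircle.coe_sub, coe_circleRep, coe_circle_eq_zero_iff.2 ⟨_, rfl⟩, sub_zero]
  · rw [← coe_circleRep z, UnitAddCircle.norm_eq, coe_circleRep]

/-- The two-sided drift. Backward times are forward times for the rotation by `-α`. -/
lemma IsPiecewiseConstant.exists_cocycle_drift {f : UnitAddCircle → ℝ}
    (hf : IsPiecewiseConstant f) (hdisc : (discontinuities f).Nonempty) {α c : ℝ}
    (hα : IsBadlyApproximable α c) (hP1 : PropertyP1 α f) (σ : ℤ) (hσ : σ = 1 ∨ σ = -1) :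
    ∃ c' C : ℝ, 0 < c' ∧ ∀ᶠ h : ℝ in 𝓝[>] 0, ∀ x y : UnitAddCircle, ‖y - x‖ = h →
      (∀ k : ℤ, x + k • (α : UnitAddCircle) ∉ discontinuities f) →
      (∀ k : ℤ, y + k • (α : UnitAddCircle) ∉ discontinuities f) →
      ∃ a w : ℕ, c' ≤ w * h ∧ c' ≤ a * h ∧ (a + w) * h ≤ C ∧
        ∃ ρ ∈ driftSet hf.finite_discontinuities.toFinset f, ∀ n : ℕ, a ≤ n → n ≤ a + w →
          rotationCocycle α f (σ * n) y - rotationCocycle α f (σ * n) x = ρ := by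
  suffices H : ∃ c' C : ℝ, 0 < c' ∧ ∀ᶠ h : ℝ in 𝓝[>] 0, ∀ x : UnitAddCircle,
      (∀ k : ℤ, x + k • (α : UnitAddCircle) ∉ discontinuities f) →
      (∀ k : ℤ, x + (h : UnitAddCircle) + k • (α : UnitAddCircle) ∉ discontinuities f) →
      ∃ a w : ℕ, c' ≤ w * h ∧ c' ≤ a * h ∧ (a + w) * h ≤ C ∧
        ∃ ρ ∈ driftSet hf.finite_discontinuities.toFinset f, ∀ n : ℕ, a ≤ n → n ≤ a + w →
          rotationCocycle α f (σ * n) (x + (h : UnitAddCircle)) -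
            rotationCocycle α f (σ * n) x = ρ by
    obtain ⟨c', C, hc', H⟩ := H
    refine ⟨c', C, hc', ?_⟩
    filter_upwards [H] with h H x y hxy hx hy
    obtain ⟨r, hr, habs⟩ := exists_abs_eq_norm (y - x)
    rw [hxy] at habs
    rcases abs_choice r with h' | h'
    · have hyx : y = x + (h : UnitAddCircle) := by rw [← habs, h', hr]; abel
      subst hyx
      exact H x hx hy
    · have hyx : x = y + (h : UnitAddCircle) := by rw [← habs, h', AddCircle.coe_neg, hr]; abel
      subst hyx
      obtain ⟨a, w, h1, h2, h3, ρ, hρ, h4⟩ := H y hy hx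
      exact ⟨a, w, h1, h2, h3, -ρ, neg_mem_driftSet hρ, fun n hn hn' => by
        rw [← h4 n hn hn']; ring⟩
  rcases hσ with rfl | rfl
  · obtain ⟨c', C, hc', H⟩ := hf.exists_drift hdisc hα hP1
    refine ⟨c', C, hc', ?_⟩
    filter_upwards [H] with h H x hx hy
    obtain ⟨a, w, h1, h2, h3, ρ, hρ, h4⟩ := H x (fun k => ⟨hx k, by
      have := hy k; rwa [add_right_comm] at this⟩)
    refine ⟨a, w, h1, h2, h3, ρ, hρ, fun n hn hn' => ?_⟩
    rw [← h4 n hn hn', one_mul, rotationCocycle_natCast, rotationCocycle_natCast,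
      Finset.sum_sub_distrib]
    simp only [add_right_comm x (h : UnitAddCircle)]
  · obtain ⟨c', C, hc', H⟩ := hf.exists_drift hdisc hα.neg hP1.neg
    refine ⟨c', C, hc', ?_⟩
    filter_upwards [H] with h H x hx hy
    have hshift : ∀ (z : UnitAddCircle) (k : ℕ),
        z - (α : UnitAddCircle) + (k : ℤ) • ((-α : ℝ) : UnitAddCircle) =
          z + (-((k : ℤ) + 1)) • (α : UnitAddCircle) := by
      intro z k
      rw [AddCircle.coe_neg, neg_smul, add_smul, one_smul, smul_neg]; abel
    obtain ⟨a, w, h1, h2, h3, ρ, hρ, h4⟩ := H (x - (α : UnitAddCircle)) (fun k => by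
      rw [hshift, add_right_comm]
      exact ⟨hx _, hy _⟩)
    refine ⟨a, w, h1, h2, h3, -ρ, neg_mem_driftSet hρ, fun n hn hn' => ?_⟩
    rw [← h4 n hn hn', neg_one_mul, rotationCocycle_neg_natCast, rotationCocycle_neg_natCast,
      Finset.sum_sub_distrib]
    simp only [add_sub_right_comm x (h : UnitAddCircle), add_right_comm _ (h : UnitAddCircle)]
    ring

/-! ### The maximal ergodic inequality -/

section Maximal

variable {X : Type*}

/-- The largest of the ergodic sums `∑_{k < n} g (T^k x)`, `n ≤ N`, where the empty sum counts. -/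
def maxErgodicSum (T : X → X) (g : X → ℝ) : ℕ → X → ℝ
  | 0 => fun _ => 0
  | N + 1 => fun x => max 0 (g x + maxErgodicSum T g N (T x))

lemma maxErgodicSum_nonneg (T : X → X) (g : X → ℝ) (N : ℕ) (x : X) :
    0 ≤ maxErgodicSum T g N x := by
  cases N with
  | zero => exact le_rfl
  | succ N => exact le_max_left _ _

lemma maxErgodicSum_mono (T : X → X) (g : X → ℝ) (N : ℕ) :
    ∀ x, maxErgodicSum T g N x ≤ maxErgodicSum T g (N + 1) x := by
  induction N with
  | zero => exact fun x => maxErgodicSum_nonneg T g 1 x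
  | succ N ih =>
    intro x
    exact max_le_max le_rfl (by linarith [ih (T x)])

lemma sum_le_maxErgodicSum (T : X → X) (g : X → ℝ) (n : ℕ) :
    ∀ x, ∑ k ∈ Finset.range n, g (T^[k] x) ≤ maxErgodicSum T g n x := by
  induction n with
  | zero => intro x; simp [maxErgodicSum]
  | succ n ih =>
    intro x
    rw [Finset.sum_range_succ']
    refine le_trans ?_ (le_max_right _ _)
    have := ih (T x)
    simp only [Function.iterate_succ, Function.comp_apply, Function.iterate_zero, id_eq]
    linarith

variable [MeasurableSpace X] {μ : Measure X} {T : X → X}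

lemma measurable_maxErgodicSum (hT : Measurable T) {g : X → ℝ} (hg : Measurable g) (N : ℕ) :
    Measurable (maxErgodicSum T g N) := by
  induction N with
  | zero => exact measurable_const
  | succ N ih => exact measurable_const.max (hg.add (ih.comp hT))

lemma integrable_maxErgodicSum (hT : MeasurePreserving T μ μ) {g : X → ℝ} (hg : Integrable g μ)
    (N : ℕ) : Integrable (maxErgodicSum T g N) μ := by
  induction N with
  | zero => exact integrable_zero _ _ _
  | succ N ih =>
    have h := (hg.add (hT.integrable_comp_of_integrable ih)).pos_part
    refine h.congr (Eventually.of_forall fun x => ?_)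
    simp only [maxErgodicSum, Pi.add_apply, Function.comp_apply]
    rw [max_comm]

/-- Hopf's maximal ergodic lemma. On the set where `F = maxErgodicSum T g (N + 1)` is positive,
`F ≤ g + F ∘ T`, so that `F - F ∘ T ≤ 1_{F > 0} g`; the left side has integral zero. -/
lemma integral_maxErgodicSum_pos_nonneg (hT : MeasurePreserving T μ μ) {g : X → ℝ}
    (hgm : Measurable g) (hg : Integrable g μ) (N : ℕ) :
    0 ≤ ∫ x in {x | 0 < maxErgodicSum T g (N + 1) x}, g x ∂μ := by
  set F := maxErgodicSum T g (N + 1)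
  have hE : MeasurableSet {x | 0 < F x} :=
    measurableSet_lt measurable_const (measurable_maxErgodicSum hT.measurable hgm _)
  have hF : Integrable F μ := integrable_maxErgodicSum hT hg _
  have hFT : Integrable (fun x => F (T x)) μ := hT.integrable_comp_of_integrable hF
  have hint : ∫ x, F (T x) ∂μ = ∫ x, F x ∂μ := by
    have h := integral_map (μ := μ) (φ := T) (f := F) hT.measurable.aemeasurable (by
      rw [hT.map_eq]; exact hF.aestronglyMeasurable)
    rw [hT.map_eq] at h
    exact h.symm
  rw [← integral_indicator hE]
  calc (0 : ℝ) = ∫ x, (F x - F (T x)) ∂μ := by rw [integral_sub hF hFT, hint, sub_self]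
    _ ≤ _ := by
      refine integral_mono (hF.sub hFT) (hg.indicator hE) fun x => ?_
      by_cases hx : 0 < F x
      · rw [Set.indicator_of_mem (show x ∈ {x | 0 < F x} from hx)]
        have h1 : F x = max 0 (g x + maxErgodicSum T g N (T x)) := rfl
        have h2 : F x = g x + maxErgodicSum T g N (T x) := by
          rcases max_choice 0 (g x + maxErgodicSum T g N (T x)) with h | h
          · rw [h] at h1; exact absurd h1 hx.ne'
          · rw [h1, h]
        have h3 : maxErgodicSum T g N (T x) ≤ F (T x) := maxErgodicSum_mono T g N (T x)
        simp only
        linarith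
      · rw [Set.indicator_of_notMem (show x ∉ {x | 0 < F x} from hx)]
        have h3 : 0 ≤ F (T x) := maxErgodicSum_nonneg T g _ _
        simp only
        linarith

/-- The maximal inequality for visits: outside a set of measure at most `μ B / r`, the proportion of
visits to `B` is at most `r` along every initial piece of the orbit. -/
theorem exists_measurableSet_visits_le [IsFiniteMeasure μ] (hT : MeasurePreserving T μ μ)
    {B : Set X} (hB : MeasurableSet B) {r : ℝ} (hr : 0 < r) :
    ∃ E : Set X, MeasurableSet E ∧ μ.real E ≤ μ.real B / r ∧ ∀ x ∉ E, ∀ n : ℕ,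
      ∑ k ∈ Finset.range n, B.indicator (fun _ => (1 : ℝ)) (T^[k] x) ≤ r * n := by
  set g : X → ℝ := fun x => B.indicator (fun _ => (1 : ℝ)) x - r
  have hBm : Measurable (B.indicator fun _ => (1 : ℝ)) := measurable_const.indicator hB
  have hBi : Integrable (B.indicator fun _ => (1 : ℝ)) μ := (integrable_const _).indicator hB
  have hgm : Measurable g := hBm.sub measurable_const
  have hgi : Integrable g μ := hBi.sub (integrable_const _)
  set E : ℕ → Set X := fun N => {x | 0 < maxErgodicSum T g (N + 1) x}
  have hE : ∀ N, MeasurableSet (E N) := fun N =>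
    measurableSet_lt measurable_const (measurable_maxErgodicSum hT.measurable hgm _)
  have hmono : Monotone E := monotone_nat_of_le_succ fun N x hx =>
    lt_of_lt_of_le (show 0 < maxErgodicSum T g (N + 1) x from hx) (maxErgodicSum_mono T g (N + 1) x)
  have hbound : ∀ N, μ.real (E N) ≤ μ.real B / r := by
    intro N
    have h := integral_maxErgodicSum_pos_nonneg hT hgm hgi N
    change 0 ≤ ∫ x in E N, (B.indicator (fun _ => (1 : ℝ)) x - r) ∂μ at h
    rw [integral_sub hBi.integrableOn (integrable_const _).integrableOn] at h
    rw [setIntegral_indicator hB, setIntegral_const, setIntegral_const, smul_eq_mul, smul_eq_mul,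
      mul_one] at h
    rw [le_div_iff₀ hr]
    have : μ.real (E N ∩ B) ≤ μ.real B := measureReal_mono Set.inter_subset_right
    linarith
  refine ⟨⋃ N, E N, MeasurableSet.iUnion hE, ?_, fun x hx n => ?_⟩
  · have h1 := tendsto_measure_iUnion_atTop (μ := μ) hmono
    have h2 := (ENNReal.tendsto_toReal (measure_ne_top μ _)).comp h1
    exact le_of_tendsto' h2 hbound
  · have h1 : x ∉ E n := fun h => hx (Set.mem_iUnion.2 ⟨n, h⟩)
    have h2 : maxErgodicSum T g (n + 1) x ≤ 0 := not_lt.1 h1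
    have h3 := (sum_le_maxErgodicSum T g n x).trans ((maxErgodicSum_mono T g n x).trans h2)
    simp only [g, Finset.sum_sub_distrib, Finset.sum_const, Finset.card_range, nsmul_eq_mul] at h3
    linarith

end Maximal

/-! ### The special flow -/

section SpecialFlow

variable {α : ℝ} {f : UnitAddCircle → ℝ}

lemma rotationCocycle_zero (α : ℝ) (f : UnitAddCircle → ℝ) (x : UnitAddCircle) :
    rotationCocycle α f 0 x = 0 := by
  simp [rotationCocycle]

lemma rotationCocycle_add (α : ℝ) (f : UnitAddCircle → ℝ) (m n : ℤ) (x : UnitAddCircle) :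
    rotationCocycle α f (m + n) x =
      rotationCocycle α f m x + rotationCocycle α f n (x + m • (α : UnitAddCircle)) := by
  induction n using Int.induction_on with
  | zero => simp [rotationCocycle_zero]
  | succ n ih =>
    rw [← add_assoc, rotationCocycle_succ, rotationCocycle_succ, ih, add_smul]
    simp only [add_assoc]
  | pred n ih =>
    have h1 := rotationCocycle_succ α f (m + (-(n : ℤ) - 1)) x
    have h2 := rotationCocycle_succ α f (-(n : ℤ) - 1) (x + m • (α : UnitAddCircle))
    rw [show m + (-(n : ℤ) - 1) + 1 = m + -n by ring, ih] at h1
    rw [show -(n : ℤ) - 1 + 1 = -n by ring] at h2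
    have h3 : x + (m + (-(n : ℤ) - 1)) • (α : UnitAddCircle) =
        x + m • (α : UnitAddCircle) + (-(n : ℤ) - 1) • (α : UnitAddCircle) := by
      rw [add_smul, add_assoc]
    rw [h3] at h1
    linarith

lemma strictMono_rotationCocycle (α : ℝ) (hpos : ∀ x, 0 < f x) (x : UnitAddCircle) :
    StrictMono fun n => rotationCocycle α f n x :=
  strictMono_int_of_lt_succ fun n => by
    rw [rotationCocycle_succ]; linarith [hpos (x + n • (α : UnitAddCircle))]

lemma rotationCocycle_index_unique (hpos : ∀ x, 0 < f x) {x : UnitAddCircle} {r : ℝ} {m n : ℤ}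
    (hm : rotationCocycle α f m x ≤ r) (hm' : r < rotationCocycle α f (m + 1) x)
    (hn : rotationCocycle α f n x ≤ r) (hn' : r < rotationCocycle α f (n + 1) x) : m = n := by
  have h1 := (strictMono_rotationCocycle α hpos x).lt_iff_lt.1 (hm.trans_lt hn')
  have h2 := (strictMono_rotationCocycle α hpos x).lt_iff_lt.1 (hn.trans_lt hm')
  omega

lemma mul_le_rotationCocycle {l : ℝ} (hl : ∀ x, l ≤ f x) (n : ℕ) (x : UnitAddCircle) :
    l * n ≤ rotationCocycle α f n x := by
  rw [rotationCocycle_natCast]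
  have := Finset.card_nsmul_le_sum (Finset.range n)
    (fun k : ℕ => f (x + (k : ℤ) • (α : UnitAddCircle))) l (fun k _ => hl _)
  simpa [mul_comm] using this

lemma rotationCocycle_neg_le_mul {l : ℝ} (hl : ∀ x, l ≤ f x) (n : ℕ) (x : UnitAddCircle) :
    rotationCocycle α f (-n) x ≤ -(l * n) := by
  rw [rotationCocycle_neg_natCast]
  have := Finset.card_nsmul_le_sum (Finset.range n)
    (fun k : ℕ => f (x - (α : UnitAddCircle) + (k : ℤ) • ((-α : ℝ) : UnitAddCircle))) l
    (fun k _ => hl _)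
  rw [neg_le_neg_iff]
  simpa [mul_comm] using this

lemma exists_rotationCocycle_index {l : ℝ} (hl0 : 0 < l) (hl : ∀ x, l ≤ f x) (x : UnitAddCircle)
    (r : ℝ) : ∃ n : ℤ, rotationCocycle α f n x ≤ r ∧ r < rotationCocycle α f (n + 1) x := by
  have hmono := strictMono_rotationCocycle α (fun x => hl0.trans_le (hl x)) x
  obtain ⟨N, hN⟩ := exists_nat_gt (|r| / l)
  rw [div_lt_iff₀ hl0, mul_comm] at hN
  obtain ⟨n, hn, hmax⟩ := Int.exists_greatest_of_bdd (P := fun n => rotationCocycle α f n x ≤ r)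
    ⟨N, fun n hn => by
      have := mul_le_rotationCocycle (α := α) hl N x
      refine (hmono.lt_iff_lt.1 (?_ : rotationCocycle α f n x < rotationCocycle α f N x)).le
      exact lt_of_le_of_lt hn (lt_of_lt_of_le ((le_abs_self r).trans_lt hN) this)⟩
    ⟨-N, by
      have := rotationCocycle_neg_le_mul (α := α) hl N x
      linarith [neg_abs_le r]⟩
  refine ⟨n, hn, ?_⟩
  by_contra hcon
  have := hmax (n + 1) (not_lt.1 hcon)
  omega

lemma SpecialFlowSpace.ext {z w : SpecialFlowSpace f} (h1 : z.1.fst = w.1.fst)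
    (h2 : z.1.snd = w.1.snd) : z = w := by
  apply Subtype.ext
  apply (WithLp.equiv 1 (UnitAddCircle × ℝ)).injective
  exact Prod.ext h1 h2

lemma specialFlow_of_index (hpos : ∀ x, 0 < f x) {t : ℝ} {z : SpecialFlowSpace f} {n : ℤ}
    (h1 : rotationCocycle α f n z.1.fst ≤ z.1.snd + t)
    (h2 : z.1.snd + t < rotationCocycle α f (n + 1) z.1.fst) :
    (specialFlow α f t z).1.fst = z.1.fst + n • (α : UnitAddCircle) ∧
      (specialFlow α f t z).1.snd = z.1.snd + t - rotationCocycle α f n z.1.fst := by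
  have h : ∃ n : ℤ, rotationCocycle α f n z.1.fst ≤ z.1.snd + t ∧
      z.1.snd + t < rotationCocycle α f (n + 1) z.1.fst := ⟨n, h1, h2⟩
  have hn : h.choose = n :=
    rotationCocycle_index_unique hpos h.choose_spec.1 h.choose_spec.2 h1 h2
  rw [specialFlow, dif_pos h]
  simp only [hn]
  exact ⟨rfl, rfl⟩

lemma specialFlow_add {l : ℝ} (hl0 : 0 < l) (hl : ∀ x, l ≤ f x) (t t' : ℝ)
    (z : SpecialFlowSpace f) :
    specialFlow α f t' (specialFlow α f t z) = specialFlow α f (t + t') z := by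
  have hpos : ∀ x, 0 < f x := fun x => hl0.trans_le (hl x)
  obtain ⟨n, hn1, hn2⟩ := exists_rotationCocycle_index (α := α) hl0 hl z.1.fst (z.1.snd + t)
  obtain ⟨e1, e2⟩ := specialFlow_of_index hpos hn1 hn2
  set w := specialFlow α f t z
  obtain ⟨m, hm1, hm2⟩ := exists_rotationCocycle_index (α := α) hl0 hl w.1.fst (w.1.snd + t')
  obtain ⟨e3, e4⟩ := specialFlow_of_index hpos hm1 hm2
  rw [e1, e2] at hm1 hm2
  have a1 := rotationCocycle_add α f n m z.1.fst
  have a2 := rotationCocycle_add α f n (m + 1) z.1.fst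
  obtain ⟨e5, e6⟩ := specialFlow_of_index (t := t + t') (z := z) (n := n + m) hpos
    (by linarith) (by rw [add_assoc]; linarith)
  apply SpecialFlowSpace.ext
  · rw [e3, e5, e1, add_smul, add_assoc]
  · rw [e4, e6, e2, e1]; linarith

lemma specialFlow_zero (hpos : ∀ x, 0 < f x) (z : SpecialFlowSpace f) :
    specialFlow α f 0 z = z := by
  obtain ⟨h1, h2⟩ := specialFlow_of_index (α := α) (t := 0) (z := z) (n := 0) hpos
    (by rw [rotationCocycle_zero]; linarith [z.2.1])
    (by rw [rotationCocycle_succ, rotationCocycle_zero]; simpa using z.2.2)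
  exact SpecialFlowSpace.ext (by simp [h1]) (by simp [h2, rotationCocycle_zero])

lemma iterate_specialFlow {l : ℝ} (hl0 : 0 < l) (hl : ∀ x, l ≤ f x) (t : ℝ) (n : ℕ)
    (z : SpecialFlowSpace f) : (specialFlow α f t)^[n] z = specialFlow α f (n * t) z := by
  induction n with
  | zero => simp [specialFlow_zero fun x => hl0.trans_le (hl x)]
  | succ n ih =>
    rw [Function.iterate_succ_apply', ih, specialFlow_add hl0 hl]
    congr 1; push_cast; ring

/-- Points over the same base point lie on one orbit. -/
lemma specialFlow_eq_of_fst_eq (hpos : ∀ x, 0 < f x) {z w : SpecialFlowSpace f}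
    (h : z.1.fst = w.1.fst) : specialFlow α f (w.1.snd - z.1.snd) z = w := by
  obtain ⟨h1, h2⟩ := specialFlow_of_index (α := α) (t := w.1.snd - z.1.snd) (z := z) (n := 0) hpos
    (by rw [rotationCocycle_zero]; linarith [w.2.1])
    (by rw [rotationCocycle_succ, rotationCocycle_zero, h]; have := w.2.2; simpa using this)
  exact SpecialFlowSpace.ext (by simp [h1, h]) (by rw [h2, rotationCocycle_zero]; ring)

/-! ### Invariance of the area -/

/-- The phase space as a subset of the product of the circle and the line. -/
def toPlane (f : UnitAddCircle → ℝ) (z : SpecialFlowSpace f) : UnitAddCircle × ℝ :=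
  (z.1.fst, z.1.snd)

/-- The region under the graph of `f`. -/
def regionUnder (f : UnitAddCircle → ℝ) : Set (UnitAddCircle × ℝ) :=
  {y | 0 ≤ y.2 ∧ y.2 < f y.1}

lemma range_toPlane (f : UnitAddCircle → ℝ) : Set.range (toPlane f) = regionUnder f := by
  ext y
  refine ⟨?_, fun h => ⟨⟨WithLp.toLp 1 y, h⟩, rfl⟩⟩
  rintro ⟨z, rfl⟩
  exact z.2

lemma measurableSet_regionUnder (hf : Measurable f) : MeasurableSet (regionUnder f) :=
  (measurableSet_le measurable_const measurable_snd).inter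
    (measurableSet_lt measurable_snd (hf.comp measurable_fst))

lemma measurableEmbedding_toPlane (hf : Measurable f) : MeasurableEmbedding (toPlane f) := by
  have hof : MeasurableEmbedding (WithLp.ofLp : WithLp 1 (UnitAddCircle × ℝ) → UnitAddCircle × ℝ) :=
    (MeasurableEquiv.toLp 1 (UnitAddCircle × ℝ)).symm.measurableEmbedding
  have hs : MeasurableSet {z : WithLp 1 (UnitAddCircle × ℝ) | 0 ≤ z.snd ∧ z.snd < f z.fst} :=
    hof.measurable (measurableSet_regionUnder hf)
  exact hof.comp (MeasurableEmbedding.subtype_coe hs)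

lemma specialFlowArea_apply (hf : Measurable f) (A : Set (SpecialFlowSpace f)) :
    specialFlowArea f A = volume (toPlane f '' A) :=
  (measurableEmbedding_toPlane hf).comap_apply volume A

/-- The lift `(x, s) ↦ (x + n α, s + t - f^{(n)}(x))` of the special flow to the plane. -/
def planeShift (α : ℝ) (f : UnitAddCircle → ℝ) (n : ℤ) (t : ℝ) (y : UnitAddCircle × ℝ) :
    UnitAddCircle × ℝ :=
  (y.1 + n • (α : UnitAddCircle), y.2 + t - rotationCocycle α f n y.1)

lemma measurable_rotationCocycle (hf : Measurable f) (n : ℤ) :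
    Measurable (rotationCocycle α f n) := by
  unfold rotationCocycle
  exact (Finset.measurable_sum _ fun k _ => hf.comp (measurable_id.add_const _)).sub
    (Finset.measurable_sum _ fun k _ => hf.comp (measurable_id.add_const _))

lemma measurePreserving_planeShift (hf : Measurable f) (n : ℤ) (t : ℝ) :
    MeasurePreserving (planeShift α f n t) volume volume := by
  have hm := measurable_rotationCocycle (α := α) hf n
  refine MeasurePreserving.skew_product (f := fun x => x + n • (α : UnitAddCircle))
    (g := fun x s => s + t - rotationCocycle α f n x)
    (measurePreserving_add_right volume _) ?_ (Eventually.of_forall fun x => ?_)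
  · exact (measurable_snd.add_const _).sub (hm.comp measurable_fst)
  · have := (measurePreserving_add_right (volume : Measure ℝ)
      (t - rotationCocycle α f n x)).map_eq
    simpa only [add_sub_assoc] using this

lemma planeShift_neg_planeShift (α : ℝ) (f : UnitAddCircle → ℝ) (n : ℤ) (t : ℝ)
    (y : UnitAddCircle × ℝ) : planeShift α f (-n) (-t) (planeShift α f n t y) = y := by
  have h := rotationCocycle_add α f n (-n) y.1
  rw [add_neg_cancel, rotationCocycle_zero] at h
  ext
  · simp [planeShift]
  · simp only [planeShift]; linarith

lemma planeShift_mem_regionUnder_iff {n : ℤ} {t : ℝ} {y : UnitAddCircle × ℝ} :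
    planeShift α f n t y ∈ regionUnder f ↔ rotationCocycle α f n y.1 ≤ y.2 + t ∧
      y.2 + t < rotationCocycle α f (n + 1) y.1 := by
  rw [rotationCocycle_succ]
  simp only [planeShift, regionUnder, Set.mem_ofPred_eq, sub_nonneg]
  refine and_congr_right fun _ => ?_
  constructor <;> intro h <;> linarith

lemma toPlane_specialFlow (hpos : ∀ x, 0 < f x) {n : ℤ} {t : ℝ} {z : SpecialFlowSpace f}
    (h : planeShift α f n t (toPlane f z) ∈ regionUnder f) :
    toPlane f (specialFlow α f t z) = planeShift α f n t (toPlane f z) := by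
  obtain ⟨h1, h2⟩ := planeShift_mem_regionUnder_iff.1 h
  obtain ⟨e1, e2⟩ := specialFlow_of_index hpos h1 h2
  exact Prod.ext e1 e2

lemma preimage_specialFlow {l : ℝ} (hl0 : 0 < l) (hl : ∀ x, l ≤ f x) (t : ℝ)
    (A : Set (SpecialFlowSpace f)) : specialFlow α f t ⁻¹' A =
      ⋃ n : ℤ, toPlane f ⁻¹' (planeShift α f n t ⁻¹' (toPlane f '' A)) := by
  have hpos : ∀ x, 0 < f x := fun x => hl0.trans_le (hl x)
  have hinj : Function.Injective (toPlane f) := fun z w h =>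
    SpecialFlowSpace.ext (congrArg Prod.fst h) (congrArg Prod.snd h)
  ext z
  simp only [Set.mem_preimage, Set.mem_iUnion]
  constructor
  · intro hz
    obtain ⟨n, h1, h2⟩ := exists_rotationCocycle_index (α := α) hl0 hl z.1.fst (z.1.snd + t)
    exact ⟨n, _, hz, toPlane_specialFlow hpos (planeShift_mem_regionUnder_iff.2 ⟨h1, h2⟩)⟩
  · rintro ⟨n, w, hw, hwz⟩
    have hmem : planeShift α f n t (toPlane f z) ∈ regionUnder f := by
      rw [← hwz, ← range_toPlane]; exact ⟨w, rfl⟩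
    rw [← toPlane_specialFlow hpos hmem] at hwz
    rwa [← hinj hwz]

/-- The special flow preserves the area: the images of the region under the graph by the maps
`planeShift α f n t`, `n ∈ ℤ`, tile the plane. -/
theorem measurePreserving_specialFlow (hf : Measurable f) {l : ℝ} (hl0 : 0 < l)
    (hl : ∀ x, l ≤ f x) (t : ℝ) :
    MeasurePreserving (specialFlow α f t) (specialFlowArea f) (specialFlowArea f) := by
  have hpos : ∀ x, 0 < f x := fun x => hl0.trans_le (hl x)
  have hemb := measurableEmbedding_toPlane hf
  have hshift := fun n t => measurePreserving_planeShift (α := α) hf n t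
  have hmeas : ∀ A, MeasurableSet A → ∀ n : ℤ,
      MeasurableSet (toPlane f ⁻¹' (planeShift α f n t ⁻¹' (toPlane f '' A))) := fun A hA n =>
    hemb.measurable ((hshift n t).measurable (hemb.measurableSet_image.2 hA))
  have hT : Measurable (specialFlow α f t) := fun A hA => by
    rw [preimage_specialFlow hl0 hl]
    exact MeasurableSet.iUnion (hmeas A hA)
  refine ⟨hT, Measure.ext fun A hA => ?_⟩
  rw [Measure.map_apply hT hA, preimage_specialFlow hl0 hl]
  set A' := toPlane f '' A
  have hA'm : MeasurableSet A' := hemb.measurableSet_image.2 hA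
  have hA'sub : A' ⊆ regionUnder f := by
    rw [← range_toPlane]; exact Set.image_subset_range _ _
  have hD := measurableSet_regionUnder hf
  have hdisj : Pairwise (Function.onFun Disjoint fun n : ℤ =>
      toPlane f ⁻¹' (planeShift α f n t ⁻¹' A')) := by
    intro m n hmn
    refine Set.disjoint_left.2 fun z hz hz' => hmn ?_
    obtain ⟨a1, a2⟩ := planeShift_mem_regionUnder_iff.1 (hA'sub hz)
    obtain ⟨b1, b2⟩ := planeShift_mem_regionUnder_iff.1 (hA'sub hz')
    exact rotationCocycle_index_unique hpos a1 a2 b1 b2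
  have h1 : ∀ n : ℤ, specialFlowArea f (toPlane f ⁻¹' (planeShift α f n t ⁻¹' A')) =
      volume (planeShift α f (-n) (-t) ⁻¹' regionUnder f ∩ A') := by
    intro n
    rw [specialFlowArea_apply hf, Set.image_preimage_eq_inter_range, range_toPlane,
      ← (hshift n t).measure_preimage
        (((hshift (-n) (-t)).measurable hD).inter hA'm).nullMeasurableSet]
    congr 1
    ext y
    simp only [Set.mem_inter_iff, Set.mem_preimage, planeShift_neg_planeShift]
    tauto
  rw [measure_iUnion hdisj (hmeas A hA), tsum_congr h1, ← measure_iUnion]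
  · rw [specialFlowArea_apply hf, ← Set.iUnion_inter]
    congr 1
    refine Set.inter_eq_right.2 fun y _ => Set.mem_iUnion.2 ?_
    obtain ⟨n, hn1, hn2⟩ := exists_rotationCocycle_index (α := α) hl0 hl y.1 (y.2 + -t)
    refine ⟨-n, ?_⟩
    rw [Set.mem_preimage, neg_neg]
    exact planeShift_mem_regionUnder_iff.2 ⟨hn1, hn2⟩
  · intro m n hmn
    refine Set.disjoint_left.2 fun y hy hy' => hmn ?_
    obtain ⟨a1, a2⟩ := planeShift_mem_regionUnder_iff.1 hy.1
    obtain ⟨b1, b2⟩ := planeShift_mem_regionUnder_iff.1 hy'.1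
    exact neg_injective (rotationCocycle_index_unique hpos a1 a2 b1 b2)
  · exact fun n => ((hshift (-n) (-t)).measurable hD).inter hA'm

lemma volume_univ_prod (I : Set ℝ) :
    volume ((Set.univ : Set UnitAddCircle) ×ˢ I) = volume I := by
  rw [Measure.volume_eq_prod, Measure.prod_prod, UnitAddCircle.measure_univ, one_mul]

lemma le_specialFlowArea_univ (hf : Measurable f) {l : ℝ} (hl : ∀ x, l ≤ f x) :
    ENNReal.ofReal l ≤ specialFlowArea f Set.univ := by
  rw [specialFlowArea_apply hf, Set.image_univ, range_toPlane]
  calc ENNReal.ofReal l = volume ((Set.univ : Set UnitAddCircle) ×ˢ Set.Ico 0 l) := by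
        rw [volume_univ_prod, Real.volume_Ico, sub_zero]
    _ ≤ _ := measure_mono (t := regionUnder f) fun y hy => ⟨hy.2.1, hy.2.2.trans_le (hl _)⟩

lemma specialFlowArea_univ_le (hf : Measurable f) {u : ℝ} (hu : ∀ x, f x ≤ u) :
    specialFlowArea f Set.univ ≤ ENNReal.ofReal u := by
  rw [specialFlowArea_apply hf, Set.image_univ, range_toPlane]
  calc _ ≤ volume ((Set.univ : Set UnitAddCircle) ×ˢ Set.Ico 0 u) :=
        measure_mono fun y hy => ⟨trivial, hy.1, hy.2.trans_le (hu _)⟩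
    _ = _ := by rw [volume_univ_prod, Real.volume_Ico, sub_zero]

/-- The points of the phase space at height less than `δ` above the floor or at most `δ` below the
roof. -/
def boundaryStrip (f : UnitAddCircle → ℝ) (δ : ℝ) : Set (SpecialFlowSpace f) :=
  {z | z.1.snd < δ ∨ f z.1.fst - z.1.snd ≤ δ}

lemma measurableSet_boundaryStrip (hf : Measurable f) (δ : ℝ) :
    MeasurableSet (boundaryStrip f δ) := by
  have h1 : MeasurableSet {y : UnitAddCircle × ℝ | y.2 < δ ∨ f y.1 - y.2 ≤ δ} :=
    (measurableSet_lt measurable_snd measurable_const).union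
      (measurableSet_le ((hf.comp measurable_fst).sub measurable_snd) measurable_const)
  exact (measurableEmbedding_toPlane hf).measurable h1

lemma specialFlowArea_boundaryStrip_le (hf : Measurable f) (δ : ℝ) :
    specialFlowArea f (boundaryStrip f δ) ≤ ENNReal.ofReal δ + ENNReal.ofReal δ := by
  rw [specialFlowArea_apply hf]
  have hsub : toPlane f '' boundaryStrip f δ ⊆
      ((Set.univ : Set UnitAddCircle) ×ˢ Set.Ico 0 δ) ∪
        planeShift 0 f 1 0 ⁻¹' ((Set.univ : Set UnitAddCircle) ×ˢ Set.Ico (-δ) 0) := by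
    rintro _ ⟨z, hz, rfl⟩
    have hc : rotationCocycle 0 f 1 z.1.fst = f z.1.fst := by
      have := rotationCocycle_succ 0 f 0 z.1.fst
      rw [rotationCocycle_zero] at this
      simpa using this
    rcases hz with hz | hz
    · exact Or.inl ⟨trivial, z.2.1, hz⟩
    · refine Or.inr ⟨trivial, ?_, ?_⟩
      · simp only [planeShift, toPlane, hc]; linarith
      · simp only [planeShift, toPlane, hc]; linarith [z.2.2]
  refine (measure_mono hsub).trans ((measure_union_le _ _).trans ?_)
  rw [(measurePreserving_planeShift hf 1 0).measure_preimage
    (MeasurableSet.univ.prod measurableSet_Ico).nullMeasurableSet, volume_univ_prod,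
    volume_univ_prod, Real.volume_Ico, Real.volume_Ico]
  simp

lemma specialFlowArea_preimage_countable (hf : Measurable f) {s : Set UnitAddCircle}
    (hs : s.Countable) : specialFlowArea f {z | z.1.fst ∈ s} = 0 := by
  rw [specialFlowArea_apply hf]
  refine measure_mono_null (t := s ×ˢ (Set.univ : Set ℝ)) ?_ ?_
  · rintro _ ⟨z, hz, rfl⟩
    exact ⟨hz, trivial⟩
  · have : NullSingletonClass (volume : Measure UnitAddCircle) := ⟨fun x => by
      rw [← Metric.closedBall_zero, AddCircle.volume_closedBall]; simp⟩
    rw [Measure.volume_eq_prod, Measure.prod_prod, hs.measure_zero, zero_mul]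

lemma isProbabilityMeasure_specialFlowMeasure (hf : Measurable f) {l u : ℝ} (hl0 : 0 < l)
    (hl : ∀ x, l ≤ f x) (hu : ∀ x, f x ≤ u) : IsProbabilityMeasure (specialFlowMeasure f) := by
  refine ⟨?_⟩
  rw [specialFlowMeasure, Measure.smul_apply, smul_eq_mul]
  refine ENNReal.inv_mul_cancel ?_ ?_
  · exact (lt_of_lt_of_le (ENNReal.ofReal_pos.2 hl0) (le_specialFlowArea_univ hf hl)).ne'
  · exact ((specialFlowArea_univ_le hf hu).trans_lt ENNReal.ofReal_lt_top).ne

lemma specialFlowMeasure_boundaryStrip_le (hf : Measurable f) {l : ℝ} (hl0 : 0 < l)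
    (hl : ∀ x, l ≤ f x) {δ : ℝ} (hδ : 0 ≤ δ) :
    (specialFlowMeasure f).real (boundaryStrip f δ) ≤ 2 * δ / l := by
  refine ENNReal.toReal_le_of_le_ofReal (by positivity) ?_
  rw [specialFlowMeasure, Measure.smul_apply, smul_eq_mul]
  calc _ ≤ (ENNReal.ofReal l)⁻¹ * (ENNReal.ofReal δ + ENNReal.ofReal δ) := by
        gcongr
        · exact le_specialFlowArea_univ hf hl
        · exact specialFlowArea_boundaryStrip_le hf δ
    _ = ENNReal.ofReal (2 * δ / l) := by
        rw [← ENNReal.ofReal_add hδ hδ, ← ENNReal.ofReal_inv_of_pos hl0,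
          ← ENNReal.ofReal_mul (by positivity)]
        congr 1; ring

end SpecialFlow

/-! ### From the drift to Ratner's property -/

section Ratner

variable {α : ℝ} {f : UnitAddCircle → ℝ}

lemma rotationCocycle_bounds {l u : ℝ} (hl : ∀ x, l ≤ f x) (hu : ∀ x, f x ≤ u) {σ : ℤ}
    (hσ : σ = 1 ∨ σ = -1) (n : ℕ) (x : UnitAddCircle) :
    l * n ≤ σ * rotationCocycle α f (σ * n) x ∧ σ * rotationCocycle α f (σ * n) x ≤ u * n := by
  have key : ∀ (y : UnitAddCircle) (β : UnitAddCircle),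
      l * n ≤ ∑ k ∈ Finset.range n, f (y + (k : ℤ) • β) ∧
        ∑ k ∈ Finset.range n, f (y + (k : ℤ) • β) ≤ u * n := by
    intro y β
    have h1 := Finset.card_nsmul_le_sum (Finset.range n) (fun k : ℕ => f (y + (k : ℤ) • β)) l
      (fun k _ => hl _)
    have h2 := Finset.sum_le_card_nsmul (Finset.range n) (fun k : ℕ => f (y + (k : ℤ) • β)) u
      (fun k _ => hu _)
    rw [Finset.card_range, nsmul_eq_mul, mul_comm] at h1 h2
    exact ⟨h1, h2⟩
  rcases hσ with rfl | rfl
  · rw [one_mul, rotationCocycle_natCast, Int.cast_one, one_mul]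
    exact key _ _
  · rw [neg_one_mul, rotationCocycle_neg_natCast, Int.cast_neg, Int.cast_one, neg_one_mul, neg_neg]
    exact key _ _

lemma dist_specialFlowSpace (z w : SpecialFlowSpace f) :
    dist z w = ‖z.1.fst - w.1.fst‖ + |z.1.snd - w.1.snd| := by
  rw [Subtype.dist_eq, WithLp.prod_dist_eq_add (by simp)]
  simp [dist_eq_norm]

/-- Two points move in parallel, with time shift `ρ`, while their cocycles differ by `ρ` and the
first of them stays away from the floor and the roof. -/
lemma dist_specialFlow_of_drift (hpos : ∀ x, 0 < f x) {t ρ δ : ℝ} {z w : SpecialFlowSpace f}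
    {n : ℤ} (h1 : rotationCocycle α f n z.1.fst ≤ z.1.snd + t)
    (h2 : z.1.snd + t < rotationCocycle α f (n + 1) z.1.fst)
    (hn : rotationCocycle α f n w.1.fst - rotationCocycle α f n z.1.fst = ρ)
    (hn' : rotationCocycle α f (n + 1) w.1.fst - rotationCocycle α f (n + 1) z.1.fst = ρ)
    (hstrip : specialFlow α f t z ∉ boundaryStrip f δ) (hzw : dist z w < δ) :
    dist (specialFlow α f t z) (specialFlow α f (t + ρ) w) = dist z w := by
  obtain ⟨e1, e2⟩ := specialFlow_of_index hpos h1 h2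
  have hs : |z.1.snd - w.1.snd| < δ := by
    rw [dist_specialFlowSpace] at hzw
    linarith [norm_nonneg (z.1.fst - w.1.fst)]
  rw [abs_lt] at hs
  simp only [boundaryStrip, Set.mem_ofPred_eq, not_or, not_lt, not_le] at hstrip
  obtain ⟨hs1, hs2⟩ := hstrip
  rw [e1, e2] at hs2
  rw [e2] at hs1
  have h3 := rotationCocycle_succ α f n z.1.fst
  obtain ⟨e3, e4⟩ := specialFlow_of_index (α := α) (t := t + ρ) (z := w) (n := n) hpos
    (by linarith) (by linarith)
  rw [dist_specialFlowSpace, dist_specialFlowSpace, e1, e2, e3, e4]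
  congr 2
  · abel
  · linarith

/-- The drift in the time of the flow `n ↦ T_{nγ}`: for base points at a small distance the cocycle
difference is constant along the whole time window `[M, M + L]`, with `L / M` bounded below. -/
lemma IsPiecewiseConstant.exists_flow_drift (hf : IsPiecewiseConstant f)
    (hdisc : (discontinuities f).Nonempty) {c : ℝ} (hα : IsBadlyApproximable α c)
    (hP1 : PropertyP1 α f) {l u : ℝ} (hl0 : 0 < l) (hl : ∀ x, l ≤ f x) (hu : ∀ x, f x ≤ u)
    {γ : ℝ} (hγ : γ ≠ 0) :
    ∃ κ : ℝ, 0 < κ ∧ ∀ N : ℕ, ∀ᶠ h : ℝ in 𝓝[>] 0, ∀ x y : UnitAddCircle, ‖y - x‖ = h →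
      (∀ k : ℤ, x + k • (α : UnitAddCircle) ∉ discontinuities f) →
      (∀ k : ℤ, y + k • (α : UnitAddCircle) ∉ discontinuities f) →
      ∃ M L : ℕ, N ≤ M ∧ N ≤ L ∧ 0 < M ∧ 0 < L ∧ κ * M ≤ L ∧
        ∃ ρ ∈ driftSet hf.finite_discontinuities.toFinset f, ∀ n : ℕ, M ≤ n → n ≤ M + L →
          ∀ s : ℝ, 0 ≤ s → s < u → ∀ m : ℤ, rotationCocycle α f m x ≤ s + n * γ →
            s + n * γ < rotationCocycle α f (m + 1) x →
            rotationCocycle α f m y - rotationCocycle α f m x = ρ ∧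
              rotationCocycle α f (m + 1) y - rotationCocycle α f (m + 1) x = ρ := by
  have hpos : ∀ x, 0 < f x := fun x => hl0.trans_le (hl x)
  have hu0 : 0 < u := (hpos 0).trans_le (hu 0)
  obtain ⟨σ, hσ, hσγ⟩ : ∃ σ : ℤ, (σ = 1 ∨ σ = -1) ∧ γ = σ * |γ| := by
    rcases lt_or_gt_of_ne hγ with h | h
    · exact ⟨-1, Or.inr rfl, by rw [abs_of_neg h]; simp⟩
    · exact ⟨1, Or.inl rfl, by rw [abs_of_pos h]; simp⟩
  set g := |γ|
  have hg : 0 < g := abs_pos.2 hγ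
  obtain ⟨c', C, hc', H⟩ := hf.exists_cocycle_drift hdisc hα hP1 σ hσ
  set K₁ := (u * |C| + u) / g + 1
  set K₂ := l * c' / (2 * g)
  have hK₁ : 0 < K₁ := by positivity
  have hK₂ : 0 < K₂ := by positivity
  refine ⟨K₂ / K₁, by positivity, fun N => ?_⟩
  have small : ∀ r : ℝ, 0 < r → ∀ᶠ h : ℝ in 𝓝[>] 0, h < r := fun r hr =>
    eventually_nhdsWithin_of_eventually_nhds (eventually_lt_nhds hr)
  filter_upwards [H, small 1 one_pos, small (K₂ / (N + 1)) (by positivity),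
    small (K₂ / (2 * u / g + 2)) (by positivity), self_mem_nhdsWithin]
    with h H h1 hN hh h0 x y hxy hx hy
  replace h0 : 0 < h := h0
  obtain ⟨a, w, hw, ha, haw, ρ, hρ, hdrift⟩ := H x y hxy hx hy
  set G : ℕ → ℝ := fun n => σ * rotationCocycle α f (σ * n) x with hG
  have hGa : l * a ≤ G a ∧ G a ≤ u * a := rotationCocycle_bounds hl hu hσ a x
  have hGw : G a + l * w ≤ G (a + w) := by
    have := (rotationCocycle_bounds (α := α) hl hu hσ w
      (x + (σ * a) • (α : UnitAddCircle))).1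
    simp only [hG]
    rw [Nat.cast_add, mul_add σ, rotationCocycle_add, mul_add]
    linarith
  -- for `G a + u ≤ n g ≤ G (a + w) - u` the base index of `T_{nγ}(x, s)` lies in the drift block,
  -- whatever the height `s ∈ [0, u)` and the sign of `γ`
  set M := ⌈(G a + u) / g⌉₊
  set K := ⌊(G (a + w) - u) / g⌋₊
  have hGa0 : 0 ≤ G a := le_trans (by positivity) hGa.1
  have hM1 : (G a + u) / g ≤ M := Nat.le_ceil _
  have hM2 : (M : ℝ) < (G a + u) / g + 1 := Nat.ceil_lt_add_one (by positivity)
  have hK1 : (G (a + w) - u) / g < K + 1 := Nat.lt_floor_add_one _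
  have hMh : M * h ≤ K₁ := by
    have e1 : (a : ℝ) * h ≤ |C| := by
      have : (a : ℝ) * h ≤ (a + w) * h := by gcongr; simp
      exact this.trans (haw.trans (le_abs_self C))
    calc M * h ≤ ((u * a + u) / g + 1) * h := by gcongr; exact hM2.le.trans (by gcongr; exact hGa.2)
      _ = (u * (a * h) + u * h) / g + h := by ring
      _ ≤ (u * |C| + u * 1) / g + 1 := by gcongr
      _ = K₁ := by simp only [K₁]; ring
  have hKMh : K₂ ≤ ((K : ℝ) - M) * h := by
    have e1 : (l * w - 2 * u) / g - 2 ≤ (K : ℝ) - M := by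
      have e2 : (G a + l * w - u) / g ≤ (G (a + w) - u) / g := by gcongr
      have e3 : (l * w - 2 * u) / g = (G a + l * w - u) / g - (G a + u) / g := by ring
      linarith
    rw [lt_div_iff₀ (by positivity)] at hh
    have e4 : l * c' / g = 2 * K₂ := by simp only [K₂]; field_simp
    calc K₂ ≤ l * c' / g - h * (2 * u / g + 2) := by rw [e4]; linarith
      _ ≤ l * (w * h) / g - h * (2 * u / g + 2) := by gcongr
      _ = ((l * w - 2 * u) / g - 2) * h := by ring
      _ ≤ _ := by gcongr
  have hKM : (M : ℝ) < K := by
    have : 0 < ((K : ℝ) - M) * h := hK₂.trans_le hKMh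
    linarith [pos_of_mul_pos_left this h0.le]
  have hKM' : M < K := by exact_mod_cast hKM
  have hL : ((K - M : ℕ) : ℝ) = K - M := by rw [Nat.cast_sub hKM'.le]
  have hMh' : K₂ ≤ M * h := by
    calc K₂ ≤ l * c' / g := by
          simp only [K₂]; gcongr; linarith
      _ ≤ l * (a * h) / g := by gcongr
      _ = l * a / g * h := by ring
      _ ≤ M * h := by
          gcongr
          refine le_trans ?_ hM1
          gcongr
          linarith [hGa.1]
  have hNh : (N : ℝ) * h ≤ K₂ := by
    rw [lt_div_iff₀ (by positivity)] at hN
    nlinarith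
  have hM0 : 0 < M := Nat.ceil_pos.2 (by positivity)
  have hNM : (N : ℝ) ≤ M := le_of_mul_le_mul_right (hNh.trans hMh') h0
  have hNL : (N : ℝ) ≤ (K : ℝ) - M := le_of_mul_le_mul_right (hNh.trans hKMh) h0
  refine ⟨M, K - M, by exact_mod_cast hNM, by rw [← hL] at hNL; exact_mod_cast hNL, hM0,
    by omega, ?_, ρ, hρ, ?_⟩
  · rw [hL]
    refine le_of_mul_le_mul_right ?_ h0
    calc K₂ / K₁ * M * h = K₂ / K₁ * (M * h) := by ring
      _ ≤ K₂ / K₁ * K₁ := by gcongr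
      _ = K₂ := by field_simp
      _ ≤ _ := hKMh
  · intro n hn1 hn2 s hs0 hsu m hm1 hm2
    have hmono := strictMono_rotationCocycle α hpos x
    have hn3 : G a + u ≤ n * g := by
      rw [← div_le_iff₀ hg]
      exact hM1.trans (by exact_mod_cast hn1)
    have hn4 : n * g ≤ G (a + w) - u := by
      rw [← le_div_iff₀ hg]
      have hnK : n ≤ K := by omega
      exact (Nat.le_floor_iff' (by omega)).1 hnK
    rcases hσ with rfl | rfl
    · have hγg : γ = g := by simpa using hσγ
      simp only [hG, Int.cast_one, one_mul] at hn3 hn4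
      rw [hγg] at hm1 hm2
      have i1 := hmono.lt_iff_lt.1
        (show rotationCocycle α f (a : ℤ) x < rotationCocycle α f (m + 1) x by linarith)
      have i2 := hmono.lt_iff_lt.1
        (show rotationCocycle α f m x < rotationCocycle α f ((a + w : ℕ) : ℤ) x by linarith)
      obtain ⟨q, rfl⟩ := Int.eq_ofNat_of_zero_le (show 0 ≤ m by omega)
      have d1 := hdrift q (by omega) (by omega)
      have d2 := hdrift (q + 1) (by omega) (by omega)
      rw [one_mul] at d1 d2
      exact ⟨d1, by exact_mod_cast d2⟩
    · have hγg : γ = -g := by simpa using hσγ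
      simp only [hG, Int.cast_neg, Int.cast_one, neg_mul, one_mul] at hn3 hn4
      rw [hγg] at hm1 hm2
      have i1 := hmono.lt_iff_lt.1
        (show rotationCocycle α f m x < rotationCocycle α f (-(a : ℤ)) x by linarith)
      have i2 := hmono.lt_iff_lt.1
        (show rotationCocycle α f (-((a + w : ℕ) : ℤ)) x < rotationCocycle α f (m + 1) x by
          linarith)
      obtain ⟨q, hq⟩ := Int.eq_ofNat_of_zero_le (show 0 ≤ -(m + 1) by omega)
      have d1 := hdrift q (by omega) (by omega)
      have d2 := hdrift (q + 1) (by omega) (by omega)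
      rw [show -1 * (q : ℤ) = m + 1 by omega] at d1
      rw [show -1 * ((q + 1 : ℕ) : ℤ) = m by push_cast; omega] at d2
      exact ⟨d2, d1⟩

/-- If at most `r (M + L + 1)` of the points `S^n z`, `n ≤ M + L`, lie in `B`, the other times in
`[M, M + L]` are many. -/
lemma lt_ncard_div_of_visits_le {X : Type*} {B : Set X} {S : ℕ → X} {M L : ℕ} {r κ ε : ℝ}
    {A : Set ℕ} (hκ : 0 < κ) (hr : r * (1 / κ + 1) = ε / 2) (hε : 0 < ε) (hL : 0 < L)
    (hκL : κ * M ≤ L)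
    (hvisits : ∑ k ∈ Finset.range (M + L + 1), B.indicator (fun _ => (1 : ℝ)) (S k) ≤
      r * (M + L + 1 : ℕ))
    (hA : ∀ n, M ≤ n → n ≤ M + L → S n ∉ B → n ∈ A) (hA' : ∀ n ∈ A, n ≤ M + L) :
    1 - ε < (A.ncard : ℝ) / L := by
  classical
  have hL' : (0 : ℝ) < L := by exact_mod_cast hL
  have hL1 : (1 : ℝ) ≤ L := by exact_mod_cast hL
  have hr0 : 0 < r := by
    have : 0 < r * (1 / κ + 1) := by rw [hr]; positivity
    exact pos_of_mul_pos_left this (by positivity)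
  have hAfin : A.Finite := (Set.finite_Iic (M + L)).subset hA'
  set I := Finset.Icc M (M + L)
  have hsum : ((I.filter fun n => S n ∈ B).card : ℝ) ≤ r * (M + L + 1 : ℕ) := by
    refine le_trans ?_ hvisits
    rw [Finset.card_filter, Nat.cast_sum]
    calc _ ≤ ∑ k ∈ I, B.indicator (fun _ => (1 : ℝ)) (S k) :=
          Finset.sum_le_sum fun k _ => by by_cases hk : S k ∈ B <;> simp [hk]
      _ ≤ _ := Finset.sum_le_sum_of_subset_of_nonneg (fun k hk => by
          simp only [I, Finset.mem_Icc] at hk; simp only [Finset.mem_range]; omega)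
          (fun k _ _ => Set.indicator_nonneg (fun _ _ => zero_le_one) _)
  have hcard : (I.filter fun n => S n ∈ B).card + (I.filter fun n => S n ∉ B).card = L + 1 := by
    rw [Finset.card_filter_add_card_filter_not, Nat.card_Icc]; omega
  have hle : (I.filter fun n => S n ∉ B).card ≤ A.ncard := by
    rw [← Set.ncard_coe_finset]
    refine Set.ncard_le_ncard (fun n hn => ?_) hAfin
    simp only [I, Finset.coe_filter, Finset.mem_Icc, Set.mem_ofPred_eq] at hn
    exact hA n hn.1.1 hn.1.2 hn.2
  have hcard' : ((I.filter fun n => S n ∈ B).card : ℝ) + (I.filter fun n => S n ∉ B).card =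
      L + 1 := by exact_mod_cast hcard
  have hle' : ((I.filter fun n => S n ∉ B).card : ℝ) ≤ A.ncard := by exact_mod_cast hle
  have hM : (M : ℝ) ≤ 1 / κ * L := by
    rw [one_div, inv_mul_eq_div, le_div_iff₀ hκ]; linarith
  have hbound : r * (M + L + 1 : ℕ) ≤ ε * L := by
    push_cast
    calc r * ((M : ℝ) + L + 1) ≤ r * (1 / κ * (L + 1) + (L + 1)) := by
          gcongr r * ?_
          have : 0 < 1 / κ := by positivity
          nlinarith
      _ = r * (1 / κ + 1) * (L + 1) := by ring
      _ = ε / 2 * (L + 1) := by rw [hr]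
      _ ≤ ε * L := by nlinarith
  rw [lt_div_iff₀ hL']
  nlinarith

end Ratner

theorem theorem3 (α : ℝ) (hα : Irrational α) (hbpq : HasBoundedPartialQuotients α)
    (f : UnitAddCircle → ℝ) (hpos : ∀ x, 0 < f x) (hf : IsPiecewiseConstant f)
    (hdisc : (discontinuities f).Nonempty)
    (hP1 : PropertyP1 α f) (hP2 : PropertyP2 α f) :
    ∃ P : Finset ℝ, (0 : ℝ) ∉ P ∧
      ∀ γ : ℝ, γ ≠ 0 →
        HasRatnerProperty (specialFlowMeasure f) (specialFlow α f) γ P := by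
  refine ⟨driftSet hf.finite_discontinuities.toFinset f, by simp [driftSet], ?_⟩
  intro γ hγ ε hε
  obtain ⟨c, hc⟩ := hbpq.exists_isBadlyApproximable hα
  obtain ⟨l, u, hl0, -, hlu⟩ := hf.exists_bounds hpos
  have hl := fun x => (hlu x).1
  have hu := fun x => (hlu x).2
  have hm := hf.measurable
  have := isProbabilityMeasure_specialFlowMeasure hm hl0 hl hu
  obtain ⟨κ, hκ, H⟩ := hf.exists_flow_drift hdisc hc hP1 hl0 hl hu hγ
  refine ⟨κ, hκ, fun N => ?_⟩
  set r : ℝ := ε / 2 / (1 / κ + 1)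
  have hr : r * (1 / κ + 1) = ε / 2 := by simp only [r]; field_simp
  have hr0 : 0 < r := by positivity
  obtain ⟨h₀, hh₀, hH⟩ := mem_nhdsGT_iff_exists_Ioo_subset.1 (H N)
  replace hh₀ : 0 < h₀ := hh₀
  set δ := min h₀ (min ε (ε * r * l / 4))
  have hδ : 0 < δ := by positivity
  have hδh : δ ≤ h₀ := min_le_left _ _
  have hδε : δ ≤ ε := (min_le_right _ _).trans (min_le_left _ _)
  have hδl : δ ≤ ε * r * l / 4 := (min_le_right _ _).trans (min_le_right _ _)
  refine ⟨δ, hδ, ?_⟩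
  have hT : MeasurePreserving (specialFlow α f γ) (specialFlowMeasure f) (specialFlowMeasure f) :=
    (measurePreserving_specialFlow hm hl0 hl γ).smul_measure _
  obtain ⟨E, hEm, hEμ, hE⟩ :=
    exists_measurableSet_visits_le hT (measurableSet_boundaryStrip hm δ) hr0
  -- the base points whose orbit meets a discontinuity
  set Q : Set UnitAddCircle := ⋃ k : ℤ, (fun x => x + k • (α : UnitAddCircle)) ⁻¹'
    discontinuities f
  have hQ : Q.Countable := Set.countable_iUnion fun k =>
    (hf.finite_discontinuities.preimage (add_left_injective _).injOn).countable
  have hQm : MeasurableSet {z : SpecialFlowSpace f | z.1.fst ∈ Q} :=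
    (measurable_fst.comp (measurableEmbedding_toPlane hm).measurable) hQ.measurableSet
  have hQ0 : (specialFlowMeasure f).real {z | z.1.fst ∈ Q} = 0 := by
    rw [measureReal_def, specialFlowMeasure, Measure.smul_apply,
      specialFlowArea_preimage_countable hm hQ]
    simp
  refine ⟨(E ∪ {z | z.1.fst ∈ Q})ᶜ, (hEm.union hQm).compl, ?_, ?_⟩
  · rw [probReal_compl_eq_one_sub (hEm.union hQm)]
    have h1 := measureReal_union_le (μ := specialFlowMeasure f) E {z | z.1.fst ∈ Q}
    have h2 : (specialFlowMeasure f).real (boundaryStrip f δ) / r ≤ ε / 2 := by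
      rw [div_le_iff₀ hr0]
      refine (specialFlowMeasure_boundaryStrip_le hm hl0 hl hδ.le).trans ?_
      rw [div_le_iff₀ hl0]
      linarith
    linarith
  · intro z hz z' hz' horbit hdist
    simp only [Set.mem_compl_iff, Set.mem_union, Set.mem_ofPred_eq, not_or, Q, Set.mem_iUnion,
      Set.mem_preimage, not_exists] at hz hz'
    have hne : z'.1.fst - z.1.fst ≠ 0 := fun h =>
      horbit _ (specialFlow_eq_of_fst_eq hpos (sub_eq_zero.1 h).symm)
    have hnorm : ‖z'.1.fst - z.1.fst‖ < δ := by
      rw [norm_sub_rev]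
      rw [dist_specialFlowSpace] at hdist
      linarith [abs_nonneg (z.1.snd - z'.1.snd)]
    obtain ⟨M, L, hNM, hNL, hM0, hL0, hκL, ρ, hρ, hdrift⟩ :=
      hH ⟨norm_pos_iff.2 hne, hnorm.trans_le hδh⟩ z.1.fst z'.1.fst rfl hz.2 hz'.2
    refine ⟨M, L, hNM, hNL, (le_div_iff₀ (by exact_mod_cast hM0)).2 hκL, ρ, hρ, ?_⟩
    refine lt_ncard_div_of_visits_le (S := fun n => (specialFlow α f γ)^[n] z) hκ hr hε hL0 hκL
      (hE z hz.1 (M + L + 1)) (fun n hn1 hn2 hnB => ⟨hn1, hn2, ?_⟩) (fun n hn => hn.2.1)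
    simp only [iterate_specialFlow hl0 hl] at hnB
    obtain ⟨m, hm1, hm2⟩ :=
      exists_rotationCocycle_index (α := α) hl0 hl z.1.fst (z.1.snd + n * γ)
    obtain ⟨d1, d2⟩ := hdrift n hn1 hn2 z.1.snd z.2.1 (z.2.2.trans_le (hu _)) m hm1 hm2
    rw [dist_specialFlow_of_drift hpos hm1 hm2 d1 d2 hnB hdist]
    exact hdist.trans_le hδε

end
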